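/- Let $n\ge 0$ and let $(M,g)$ and $(\bar M,\bar g)$ be smooth $n$-dimensional pseudo-Riemannian manifolds (metrics of arbitrary signature) with Levi-Civita connections $\nabla$ and $\bar\nabla$. A smooth vector field $\varphi$ on $(M,g)$, not identically zero, is called concircular if there is a smooth function $\varrho$ on $M$ with $g(\nabla_Y\varphi,X)=\varrho\,g(X,Y)$ for all vector fields $X,Y$; it is of the exceptional type if $\varrho\equiv 0$ and of the basic type otherwise. The manifold $(M,g)$ is an equidistant space if it admits a concircular field, and an equidistant space of the exceptional type if, moreover, all of its concircular fields are of the exceptional type. A diffeomorphism $f\colon M\to\bar M$ is a geodesic mapping of $(M,g)$ onto $(\bar M,\bar g)$ if it maps every geodesic curve of $g$ (a regular curve $\gamma$ with $\nabla_{\dot\gamma}\dot\gamma=\theta\,\dot\gamma$ for some function $\theta$, so that the parameter need not be affine) to a geodesic curve of $\bar g$. If $(M,g)$ is an equidistant space of the exceptional type and admits a geodesic mapping onto $(\bar M,\bar g)$, then $(\bar M,\bar g)$ is an equidistant space of the exceptional type. -/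

import Mathlib

open scoped Manifold ContDiff Bundle

noncomputable section

/-- A smooth pseudo-Riemannian metric (of any signature) on a smooth `n`-dimensional manifold `M`:
a smooth field of symmetric nondegenerate bilinear forms on the tangent spaces. -/
structure PseudoRiemannianMetric (n : ℕ) (M : Type*) [TopologicalSpace M]
    [ChartedSpace (EuclideanSpace ℝ (Fin n)) M] [IsManifold (𝓡 n) ∞ M] where
  /-- The bilinear form `g_x` on the tangent space at `x`. -/
  form (x : M) : TangentSpace (𝓡 n) x →L[ℝ] TangentSpace (𝓡 n) x →L[ℝ] ℝ
  symm (x : M) (v w : TangentSpace (𝓡 n) x) : form x v w = form x w v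
  nondegenerate (x : M) (v : TangentSpace (𝓡 n) x) : (∀ w, form x v w = 0) → v = 0
  contMDiff : ContMDiff (𝓡 n)
    ((𝓡 n).prod 𝓘(ℝ, EuclideanSpace ℝ (Fin n) →L[ℝ] EuclideanSpace ℝ (Fin n) →L[ℝ] ℝ)) ∞
    (fun x ↦ Bundle.TotalSpace.mk'
      (EuclideanSpace ℝ (Fin n) →L[ℝ] EuclideanSpace ℝ (Fin n) →L[ℝ] ℝ)
      (E := fun x : M ↦ TangentSpace (𝓡 n) x →L[ℝ] TangentSpace (𝓡 n) x →L[ℝ] ℝ) x (form x))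

namespace PseudoRiemannianMetric

variable {n : ℕ} {M : Type*} [TopologicalSpace M]
  [ChartedSpace (EuclideanSpace ℝ (Fin n)) M] [IsManifold (𝓡 n) ∞ M]

/-- The metric read in the chart around `p`: the bilinear form `(u, v) ↦ g(dκ u, dκ v)` on `ℝⁿ`
at the point `y`, where `κ` is the inverse of the chart (each tangent space is by
definition a copy of `ℝⁿ`). Its components in the standard basis
are the `g_ij` of the chart. -/
def inChart (g : PseudoRiemannianMetric n M) (p : M) (y : EuclideanSpace ℝ (Fin n)) :
    EuclideanSpace ℝ (Fin n) →L[ℝ] EuclideanSpace ℝ (Fin n) →L[ℝ] ℝ :=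
  let κ := (extChartAt (𝓡 n) p).symm
  let B : EuclideanSpace ℝ (Fin n) →L[ℝ] EuclideanSpace ℝ (Fin n) →L[ℝ] ℝ := g.form (κ y)
  let L : EuclideanSpace ℝ (Fin n) →L[ℝ] EuclideanSpace ℝ (Fin n) :=
    mfderiv 𝓘(ℝ, EuclideanSpace ℝ (Fin n)) (𝓡 n) κ y
  B.bilinearComp L L

/-- The Christoffel symbols of the first kind in the chart around `p`, as the linear form
`w ↦ ½ (∂_u g(v, w) + ∂_v g(u, w) - ∂_w g(u, v))` at the point `y`. -/
def christoffelFirst (g : PseudoRiemannianMetric n M) (p : M) (y u v : EuclideanSpace ℝ (Fin n)) :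
    EuclideanSpace ℝ (Fin n) →L[ℝ] ℝ :=
  let D := fderiv ℝ (g.inChart p) y
  (1 / 2 : ℝ) • (D u v + D v u - (D.flip u).flip v)

/-- The Christoffel symbols (of the second kind) of the Levi-Civita connection in the chart around
`p`: the vector `Γ(u, v)` at `y` with `g(Γ(u, v), w) = christoffelFirst g p y u v w` for all `w`,
that is, `Γ(u, v)^k = Γ^k_ij u^i v^j`. -/
def christoffel (g : PseudoRiemannianMetric n M) (p : M) (y u v : EuclideanSpace ℝ (Fin n)) :
    EuclideanSpace ℝ (Fin n) :=
  (g.inChart p y).inverse (g.christoffelFirst p y u v)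

/-- A vector field read in the chart around `p`. -/
def fieldInChart (V : (x : M) → TangentSpace (𝓡 n) x) (p : M) (y : EuclideanSpace ℝ (Fin n)) :
    EuclideanSpace ℝ (Fin n) :=
  let κ := (extChartAt (𝓡 n) p).symm
  mfderiv (𝓡 n) 𝓘(ℝ, EuclideanSpace ℝ (Fin n)) (extChartAt (𝓡 n) p) (κ y) (V (κ y))

/-- The Levi-Civita covariant derivative `∇_u V` at `x` of a vector field `V` in the direction
`u ∈ T_x M`, computed in the preferred chart at `x` (which identifies `T_x M` with `ℝⁿ`):
`(∇_u V)^k = u^i ∂_i V^k + Γ^k_ij u^i V^j`. -/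
def covDeriv (g : PseudoRiemannianMetric n M) (V : (x : M) → TangentSpace (𝓡 n) x) (x : M)
    (u : TangentSpace (𝓡 n) x) : TangentSpace (𝓡 n) x :=
  let y : EuclideanSpace ℝ (Fin n) := extChartAt (𝓡 n) x x
  let u' : EuclideanSpace ℝ (Fin n) := u
  (fderiv ℝ (fieldInChart V x) y u' + g.christoffel x y u' (V x) : EuclideanSpace ℝ (Fin n))

/-- `γ` is a geodesic curve of `g` on the open interval `J`: a regular `C²` curve along which the
covariant derivative of the velocity is everywhere proportional to the velocity,
`∇_{γ'} γ' = θ γ'` (the parameter need not be affine). At each time `t` the equation is written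
in the preferred chart at `γ t`. -/
def IsGeodesicOn (g : PseudoRiemannianMetric n M) (γ : ℝ → M) (J : Set ℝ) : Prop :=
  ContMDiffOn 𝓘(ℝ, ℝ) (𝓡 n) 2 γ J ∧
  ∀ t ∈ J,
    let c : ℝ → EuclideanSpace ℝ (Fin n) := fun s ↦ extChartAt (𝓡 n) (γ t) (γ s)
    deriv c t ≠ 0 ∧
    ∃ θ : ℝ, deriv (deriv c) t + g.christoffel (γ t) (c t) (deriv c t) (deriv c t) = θ • deriv c t

/-- The diffeomorphism `f` is a geodesic mapping: it maps every geodesic curve of `g` to a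
geodesic curve of `g'`. -/
def IsGeodesicMapping {N : Type*} [TopologicalSpace N]
    [ChartedSpace (EuclideanSpace ℝ (Fin n)) N] [IsManifold (𝓡 n) ∞ N]
    (g : PseudoRiemannianMetric n M) (g' : PseudoRiemannianMetric n N)
    (f : M ≃ₘ^∞⟮𝓡 n, 𝓡 n⟯ N) : Prop :=
  ∀ (γ : ℝ → M) (J : Set ℝ), IsOpen J → J.OrdConnected →
    g.IsGeodesicOn γ J → g'.IsGeodesicOn (fun t ↦ f (γ t)) J

/-- The smooth vector field `φ` is concircular with the scalar field `ρ`: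
`g(∇_Y φ, X) = ρ g(X, Y)` for all tangent vectors `X, Y`. -/
def IsConcircular (g : PseudoRiemannianMetric n M) (φ : (x : M) → TangentSpace (𝓡 n) x)
    (ρ : M → ℝ) : Prop :=
  ContMDiff (𝓡 n) (𝓡 n).tangent ∞ (fun x ↦ (⟨x, φ x⟩ : TangentBundle (𝓡 n) M)) ∧
  ContMDiff (𝓡 n) 𝓘(ℝ, ℝ) ∞ ρ ∧
  ∀ (x : M) (X Y : TangentSpace (𝓡 n) x), g.form x (g.covDeriv φ x Y) X = ρ x * g.form x X Y

/-- `(M, g)` is an equidistant space: it admits a (not identically zero) concircular field. -/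
def IsEquidistant (g : PseudoRiemannianMetric n M) : Prop :=
  ∃ (φ : (x : M) → TangentSpace (𝓡 n) x) (ρ : M → ℝ), (∃ x, φ x ≠ 0) ∧ g.IsConcircular φ ρ

/-- `(M, g)` is an equidistant space of the exceptional type: it admits a concircular field, and
all of its concircular fields are of the exceptional type, that is, have `ρ = 0`. -/
def IsExceptionalEquidistant (g : PseudoRiemannianMetric n M) : Prop :=
  g.IsEquidistant ∧
  ∀ (φ : (x : M) → TangentSpace (𝓡 n) x) (ρ : M → ℝ), (∃ x, φ x ≠ 0) → g.IsConcircular φ ρ →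
    ∀ x, ρ x = 0

end PseudoRiemannianMetric

end

noncomputable section

open Topology Filter

set_option synthInstance.maxHeartbeats 200000
set_option maxSynthPendingDepth 3

namespace LocalGeometry

/-! In coordinates `κ` on `M` and `f ∘ κ` on `N` both metrics live on the same open set. Applying
the mapping to geodesics with every initial velocity shows that the Christoffel symbols differ by `ψ
⊗ id + id ⊗ ψ` for a one-form `ψ` (`exists_leviCivita_eq_of_isGeodesicMapping`). Write `G`, `H` for
the two metrics, `A = H⁻¹G`, `s = |det A| ^ (-1/(n+1))` and `a = s A`. Then `ds = 2ψs`, and `a`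
solves the Sinyukov equation `∇_v a x = g(λ, x) v + g(x, v) λ` with `λ = grad (½ tr a)` and `ψ ∘ a =
-g(λ, ·)` (`exists_sinyukov`).

Rescaling by `s ^ (-1/2)` gives a bijection between the concircular fields of the two metrics: `∇'(s
^ (-1/2) V) = s ^ (-1/2) (∇V + ψ(V) id)` (`cov_pushField`). Since `g` is exceptional, `∇V = 0`, so
the theorem amounts to `ψ(V) = 0` for every concircular `V`. As `ψ(V) = -g(λ, a⁻¹V)` and `a⁻¹V` lies
in the span of the `a^m V`, it suffices that `g(a^m V, λ) = 0` for all `m ≥ 0`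
(`formAt_endoAt_pow_gradAt_eq_zero`).

This is a strong induction on `m`. A parallel `V` is annihilated by the curvature, so the
integrability condition of the Sinyukov equation makes `λ` concircular, hence parallel, wherever `V
≠ 0` (`exists_cov_eq_smul`, `isConcircularField_gradOn`). The orthogonality relations for smaller
exponents make the field `χ = 2 g(a^m V, λ) aV - g(a^(m+1) V, V) λ` concircular with factor `2 g(a^m
V, λ) g(V, λ)` (`cov_combination`). For `m = 0` the factor is `2 g(V, λ)²`, and exceptionality makes
it vanish. For `m > 0` the induction hypothesis for `χ` and for `λ` at exponent `m - 1` reads `2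
g(a^m V, λ)² = 0`. -/

lemma two_le_infty : (2 : WithTop ℕ∞) ≤ ∞ :=
  WithTop.coe_le_coe.2 (le_top : (2 : ℕ∞) ≤ ⊤)

/-! ### Metrics on open sets of a vector space: Levi-Civita connection and coordinate changes. -/

variable {E : Type*} [NormedAddCommGroup E] [NormedSpace ℝ E]

/-- A symmetric nondegenerate bilinear form. -/
structure IsMetricForm (B : E →L[ℝ] E →L[ℝ] ℝ) : Prop where
  symm (v w : E) : B v w = B w v
  nondegenerate (v : E) : (∀ w, B v w = 0) → v = 0

namespace IsMetricForm

variable {B : E →L[ℝ] E →L[ℝ] ℝ}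

lemma ext (hB : IsMetricForm B) {u v : E} (h : ∀ w, B u w = B v w) : u = v := by
  refine sub_eq_zero.1 (hB.nondegenerate _ fun w ↦ ?_)
  simp [h w]

lemma isInvertible [FiniteDimensional ℝ E] (hB : IsMetricForm B) : B.IsInvertible := by
  have hinj : Function.Injective (B : E →ₗ[ℝ] E →L[ℝ] ℝ) := fun u v h ↦
    hB.ext fun w ↦ DFunLike.congr_fun h w
  have hrank : Module.finrank ℝ E = Module.finrank ℝ (E →L[ℝ] ℝ) := by
    rw [← (LinearMap.toContinuousLinearMap : (E →ₗ[ℝ] ℝ) ≃ₗ[ℝ] E →L[ℝ] ℝ).finrank_eq]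
    exact (Subspace.dual_finrank_eq (K := ℝ) (V := E)).symm
  refine ⟨(LinearEquiv.ofInjectiveOfFinrankEq (B : E →ₗ[ℝ] E →L[ℝ] ℝ) hinj
    hrank).toContinuousLinearEquiv, ?_⟩
  ext u v
  rfl

lemma apply_inverse [FiniteDimensional ℝ E] (hB : IsMetricForm B) (ℓ : E →L[ℝ] ℝ) :
    B (B.inverse ℓ) = ℓ := by
  obtain ⟨e, rfl⟩ := hB.isInvertible
  simp

/-- The pullback of a metric form under a linear isomorphism is a metric form. -/
lemma bilinearComp (hB : IsMetricForm B) {L : E →L[ℝ] E} (hL : L.IsInvertible) :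
    IsMetricForm (B.bilinearComp L L) := by
  obtain ⟨e, rfl⟩ := hL
  refine ⟨fun v w ↦ by simp [hB.symm], fun v hv ↦ ?_⟩
  refine e.map_eq_zero_iff.1 (hB.nondegenerate _ fun w ↦ ?_)
  simpa using hv (e.symm w)

end IsMetricForm

/-- A smooth metric on the open subset `Ω` of the vector space `E`. -/
structure IsMetricOn (G : E → E →L[ℝ] E →L[ℝ] ℝ) (Ω : Set E) : Prop where
  isOpen : IsOpen Ω
  contDiffOn : ContDiffOn ℝ ∞ G Ω
  isMetricForm (y : E) (hy : y ∈ Ω) : IsMetricForm (G y)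

/-- The linear forms `w ↦ ½ (∂_u G(v, w) + ∂_v G(u, w) - ∂_w G(u, v))`, as a bilinear function of
`u` and `v`. -/
def koszulForm (G : E → E →L[ℝ] E →L[ℝ] ℝ) (y : E) : E →L[ℝ] E →L[ℝ] E →L[ℝ] ℝ :=
  let D := fderiv ℝ G y
  (1 / 2 : ℝ) • (D + D.flip -
    ((ContinuousLinearMap.flipₗᵢ ℝ E E ℝ).toContinuousLinearEquiv.toContinuousLinearMap.comp D.flip))

/-- The Christoffel symbols of the Levi-Civita connection of `G` at `y`, as a bilinear map. -/
def leviCivita (G : E → E →L[ℝ] E →L[ℝ] ℝ) (y : E) : E →L[ℝ] E →L[ℝ] E :=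
  (ContinuousLinearMap.compL ℝ E (E →L[ℝ] ℝ) E (G y).inverse).comp (koszulForm G y)

/-- The covariant differential of the vector field `V`. -/
def cov (G : E → E →L[ℝ] E →L[ℝ] ℝ) (V : E → E) (y : E) : E →L[ℝ] E :=
  fderiv ℝ V y + (leviCivita G y).flip (V y)

lemma cov_apply (G : E → E →L[ℝ] E →L[ℝ] ℝ) (V : E → E) (y u : E) :
    cov G V y u = fderiv ℝ V y u + leviCivita G y u (V y) := rfl

lemma koszulForm_apply (G : E → E →L[ℝ] E →L[ℝ] ℝ) (y u v w : E) : koszulForm G y u v w =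
    (1 / 2 : ℝ) * (fderiv ℝ G y u v w + fderiv ℝ G y v u w - fderiv ℝ G y w u v) := rfl

namespace IsMetricOn

variable {G : E → E →L[ℝ] E →L[ℝ] ℝ} {Ω : Set E} {y : E}

lemma contDiffAt (hG : IsMetricOn G Ω) (hy : y ∈ Ω) : ContDiffAt ℝ ∞ G y :=
  hG.contDiffOn.contDiffAt (hG.isOpen.mem_nhds hy)

lemma differentiableAt (hG : IsMetricOn G Ω) (hy : y ∈ Ω) : DifferentiableAt ℝ G y :=
  (hG.contDiffAt hy).differentiableAt (by simp)

lemma fderiv_apply₂ (hG : IsMetricOn G Ω) (hy : y ∈ Ω) (u v w : E) :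
    fderiv ℝ G y u v w = fderiv ℝ (fun z ↦ G z v w) y u := by
  have h := ((hG.differentiableAt hy).hasFDerivAt.clm_apply (hasFDerivAt_const v y)).clm_apply
    (hasFDerivAt_const w y)
  rw [h.fderiv]
  simp

lemma fderiv_symm (hG : IsMetricOn G Ω) (hy : y ∈ Ω) (u v w : E) :
    fderiv ℝ G y u v w = fderiv ℝ G y u w v := by
  rw [hG.fderiv_apply₂ hy, hG.fderiv_apply₂ hy]
  congr 1
  refine Filter.EventuallyEq.fderiv_eq ?_
  filter_upwards [hG.isOpen.mem_nhds hy] with z hz using (hG.isMetricForm z hz).symm v w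

variable [FiniteDimensional ℝ E]

lemma contDiffAt_leviCivita (hG : IsMetricOn G Ω) (hy : y ∈ Ω) :
    ContDiffAt ℝ ∞ (leviCivita G) y := by
  have hD : ContDiffAt ℝ ∞ (fderiv ℝ G) y := (hG.contDiffAt hy).fderiv_right (m := ∞) (by simp)
  have hflip : ContDiffAt ℝ ∞ (fun z ↦ (fderiv ℝ G z).flip) y :=
    (ContinuousLinearMap.flipₗᵢ ℝ E E (E →L[ℝ] ℝ)).contDiff.contDiffAt.comp y hD
  have hK : ContDiffAt ℝ ∞ (koszulForm G) y :=
    ((hD.add hflip).sub (contDiffAt_const.clm_comp hflip)).const_smul (1 / 2 : ℝ)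
  have hI : ContDiffAt ℝ ∞ (fun z ↦ (G z).inverse) y :=
    ((hG.isMetricForm y hy).isInvertible.contDiffAt_map_inverse (n := ∞)).comp y (hG.contDiffAt hy)
  exact (((ContinuousLinearMap.compL ℝ E (E →L[ℝ] ℝ) E).contDiff.contDiffAt.comp y hI)).clm_comp hK

lemma apply_leviCivita (hG : IsMetricOn G Ω) (hy : y ∈ Ω) (u v w : E) :
    G y (leviCivita G y u v) w =
      (1 / 2 : ℝ) * (fderiv ℝ G y u v w + fderiv ℝ G y v u w - fderiv ℝ G y w u v) := by
  rw [← koszulForm_apply, ← (hG.isMetricForm y hy).apply_inverse (koszulForm G y u v)]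
  rfl

lemma leviCivita_symm (hG : IsMetricOn G Ω) (hy : y ∈ Ω) (u v : E) :
    leviCivita G y u v = leviCivita G y v u := by
  refine (hG.isMetricForm y hy).ext fun w ↦ ?_
  rw [hG.apply_leviCivita hy, hG.apply_leviCivita hy, hG.fderiv_symm hy w u v]
  ring

lemma fderiv_eq_leviCivita (hG : IsMetricOn G Ω) (hy : y ∈ Ω) (u v w : E) :
    fderiv ℝ G y u v w = G y (leviCivita G y u v) w + G y v (leviCivita G y u w) := by
  rw [(hG.isMetricForm y hy).symm v, hG.apply_leviCivita hy, hG.apply_leviCivita hy,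
    hG.fderiv_symm hy u w v]
  ring

/-- The Levi-Civita connection is compatible with the metric. -/
lemma fderiv_apply_apply (hG : IsMetricOn G Ω) (hy : y ∈ Ω) {V W : E → E}
    (hV : DifferentiableAt ℝ V y) (hW : DifferentiableAt ℝ W y) (u : E) :
    fderiv ℝ (fun z ↦ G z (V z) (W z)) y u = G y (cov G V y u) (W y) + G y (V y) (cov G W y u) := by
  have h := ((hG.differentiableAt hy).hasFDerivAt.clm_apply hV.hasFDerivAt).clm_apply
    hW.hasFDerivAt
  rw [h.fderiv]
  simp only [cov_apply, map_add, add_apply, ContinuousLinearMap.comp_apply,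
    ContinuousLinearMap.flip_apply, hG.fderiv_eq_leviCivita hy]
  ring

end IsMetricOn

section Transformation

variable [FiniteDimensional ℝ E] {G G' : E → E →L[ℝ] E →L[ℝ] ℝ} {Ω Ω' : Set E} {y : E} {τ : E → E}

/-- The transformation law of the Christoffel symbols under a change of coordinates. -/
lemma leviCivita_pullback (hG : IsMetricOn G Ω) (hy : y ∈ Ω) (hG' : IsMetricOn G' Ω')
    (hτy : τ y ∈ Ω') (hτ : ContDiffAt ℝ ∞ τ y) (hinv : (fderiv ℝ τ y).IsInvertible)
    (heq : ∀ᶠ z in 𝓝 y, G z = (G' (τ z)).bilinearComp (fderiv ℝ τ z) (fderiv ℝ τ z)) (u v : E) :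
    fderiv ℝ τ y (leviCivita G y u v) =
      leviCivita G' (τ y) (fderiv ℝ τ y u) (fderiv ℝ τ y v) + fderiv ℝ (fderiv ℝ τ) y u v := by
  have hτ' : DifferentiableAt ℝ (fderiv ℝ τ) y :=
    (hτ.fderiv_right (m := ∞) (by simp)).differentiableAt (by simp)
  have hsymm : ∀ u v, fderiv ℝ (fderiv ℝ τ) y u v = fderiv ℝ (fderiv ℝ τ) y v u :=
    hτ.isSymmSndFDerivAt (by simpa using two_le_infty)
  have hder : ∀ u v w, fderiv ℝ G y u v w =
      fderiv ℝ G' (τ y) (fderiv ℝ τ y u) (fderiv ℝ τ y v) (fderiv ℝ τ y w)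
      + G' (τ y) (fderiv ℝ (fderiv ℝ τ) y u v) (fderiv ℝ τ y w)
      + G' (τ y) (fderiv ℝ τ y v) (fderiv ℝ (fderiv ℝ τ) y u w) := by
    intro u v w
    rw [hG.fderiv_apply₂ hy]
    have h1 : (fun z ↦ G z v w) =ᶠ[𝓝 y]
        fun z ↦ (G' (τ z)) (fderiv ℝ τ z v) (fderiv ℝ τ z w) := by
      filter_upwards [heq] with z hz
      rw [hz]
      rfl
    rw [h1.fderiv_eq]
    have h0 : HasFDerivAt (fun z ↦ G' (τ z)) _ y := (hG'.differentiableAt hτy).hasFDerivAt.comp y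
      (hτ.differentiableAt (by simp)).hasFDerivAt
    have h2 := (h0.clm_apply
      (hτ'.hasFDerivAt.clm_apply (hasFDerivAt_const v y))).clm_apply
      (hτ'.hasFDerivAt.clm_apply (hasFDerivAt_const w y))
    rw [h2.fderiv]
    simp
    ring
  refine (hG'.isMetricForm _ hτy).ext fun w' ↦ ?_
  obtain ⟨w, rfl⟩ : ∃ w, fderiv ℝ τ y w = w' := by
    obtain ⟨e, he⟩ := hinv
    exact ⟨e.symm w', by rw [← he]; simp⟩
  have h1 : G' (τ y) (fderiv ℝ τ y (leviCivita G y u v)) (fderiv ℝ τ y w) =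
      G y (leviCivita G y u v) w := by
    rw [heq.self_of_nhds]
    rfl
  -- By symmetry of `D²τ`, its terms in the Koszul combination cancel in pairs, except for two
  -- copies of `G'(D²τ(u, v), Dτ w)`.
  rw [h1, hG.apply_leviCivita hy, map_add, add_apply,
    hG'.apply_leviCivita hτy, hder, hder, hder, hsymm v u, hsymm w u, hsymm w v,
    (hG'.isMetricForm _ hτy).symm (fderiv ℝ τ y v), (hG'.isMetricForm _ hτy).symm (fderiv ℝ τ y u)]
  ring

/-- Differentiating `V' ∘ τ = Dτ V` produces the term `D²τ(u, V)`, which is exactly the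
inhomogeneous term in the transformation law of the Christoffel symbols. -/
lemma cov_pullback (hG : IsMetricOn G Ω) (hy : y ∈ Ω) (hG' : IsMetricOn G' Ω')
    (hτy : τ y ∈ Ω') (hτ : ContDiffAt ℝ ∞ τ y) (hinv : (fderiv ℝ τ y).IsInvertible)
    (heq : ∀ᶠ z in 𝓝 y, G z = (G' (τ z)).bilinearComp (fderiv ℝ τ z) (fderiv ℝ τ z))
    {V V' : E → E} (hV : DifferentiableAt ℝ V y) (hV' : DifferentiableAt ℝ V' (τ y))
    (hVV' : ∀ᶠ z in 𝓝 y, V' (τ z) = fderiv ℝ τ z (V z)) (u : E) :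
    fderiv ℝ τ y (cov G V y u) = cov G' V' (τ y) (fderiv ℝ τ y u) := by
  have hτ' : DifferentiableAt ℝ (fderiv ℝ τ) y :=
    (hτ.fderiv_right (m := ∞) (by simp)).differentiableAt (by simp)
  have h1 := (hV'.hasFDerivAt.comp y (hτ.differentiableAt (by simp)).hasFDerivAt)
  have h2 := (hτ'.hasFDerivAt.clm_apply hV.hasFDerivAt)
  have h3 := DFunLike.congr_fun (h1.unique (h2.congr_of_eventuallyEq hVV')) u
  simp only [ContinuousLinearMap.comp_apply, add_apply,
    ContinuousLinearMap.flip_apply] at h3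
  rw [cov_apply, cov_apply, map_add, leviCivita_pullback hG hy hG' hτy hτ hinv heq, h3,
    hVV'.self_of_nhds]
  abel

/-- The acceleration of a curve transforms like a vector under a change of coordinates. -/
lemma acceleration_pullback (hG : IsMetricOn G Ω) {c : ℝ → E} {t : ℝ} (hy : c t ∈ Ω)
    (hG' : IsMetricOn G' Ω') (hτy : τ (c t) ∈ Ω') (hτ : ContDiffAt ℝ ∞ τ (c t))
    (hinv : (fderiv ℝ τ (c t)).IsInvertible)
    (heq : ∀ᶠ z in 𝓝 (c t), G z = (G' (τ z)).bilinearComp (fderiv ℝ τ z) (fderiv ℝ τ z))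
    (hc : ∀ᶠ s in 𝓝 t, DifferentiableAt ℝ c s) (hc' : DifferentiableAt ℝ (deriv c) t) :
    deriv (fun s ↦ τ (c s)) t = fderiv ℝ τ (c t) (deriv c t) ∧
    deriv (deriv fun s ↦ τ (c s)) t + leviCivita G' (τ (c t)) (deriv (fun s ↦ τ (c s)) t)
        (deriv (fun s ↦ τ (c s)) t) =
      fderiv ℝ τ (c t) (deriv (deriv c) t + leviCivita G (c t) (deriv c t) (deriv c t)) := by
  have hτ' : DifferentiableAt ℝ (fderiv ℝ τ) (c t) :=
    (hτ.fderiv_right (m := ∞) (by simp)).differentiableAt (by simp)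
  have hev : ∀ᶠ s in 𝓝 t, deriv (fun s ↦ τ (c s)) s = fderiv ℝ τ (c s) (deriv c s) := by
    have h1 : ∀ᶠ z in 𝓝 (c t), DifferentiableAt ℝ τ z := by
      filter_upwards [(hτ.of_le (by simp : (1 : WithTop ℕ∞) ≤ ∞)).eventually (by simp)] with z hz
      exact hz.differentiableAt (by simp)
    filter_upwards [hc.self_of_nhds.continuousAt.eventually h1, hc] with s hs hs'
    exact (hs.hasFDerivAt.comp_hasDerivAt s hs'.hasDerivAt).deriv
  have h2 := ((hτ'.hasFDerivAt.comp_hasDerivAt t hc.self_of_nhds.hasDerivAt).clm_apply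
    hc'.hasDerivAt).congr_of_eventuallyEq hev
  refine ⟨hev.self_of_nhds, ?_⟩
  rw [h2.deriv, hev.self_of_nhds, map_add, leviCivita_pullback hG hy hG' hτy hτ hinv heq]
  simp only [Function.comp_def]
  abel

end Transformation

end LocalGeometry

/-! ### Pure-trace quadratic maps, existence of geodesics, zeros of parallel fields. -/

namespace LocalGeometry

variable {E : Type*} [NormedAddCommGroup E] [NormedSpace ℝ E] [FiniteDimensional ℝ E]

/-- A symmetric bilinear map `S` with `S(v, v)` proportional to `v` for every `v` is of the form
`S(u, v) = ψ(u) v + ψ(v) u`. -/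
lemma exists_eq_smul_add_smul (S : E →L[ℝ] E →L[ℝ] E) (hS : ∀ u v, S u v = S v u)
    (h : ∀ v, ∃ θ : ℝ, S v v = θ • v) :
    ∃ ψ : E →L[ℝ] ℝ, ∀ u v, S u v = ψ u • v + ψ v • u := by
  -- At `v = 0` the factor is arbitrary; the value `0` is the one that makes `θ` linear.
  have h' : ∀ v, ∃ θ : ℝ, S v v = θ • v ∧ (v = 0 → θ = 0) := by
    intro v
    by_cases hv : v = 0
    · exact ⟨0, by simp [hv], fun _ ↦ rfl⟩
    · obtain ⟨θ, hθ⟩ := h v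
      exact ⟨θ, hθ, fun h0 ↦ absurd h0 hv⟩
  choose θ hθ hθ0 using h'
  have hsmul : ∀ (c : ℝ) v, θ (c • v) = c * θ v := by
    intro c v
    by_cases hv : v = 0
    · simp [hv, hθ0 0 rfl]
    by_cases hc : c = 0
    · simp [hc, hθ0 0 rfl]
    have h1 := hθ (c • v)
    rw [map_smul, map_smul, smul_apply, hθ v, smul_smul, smul_smul, smul_smul] at h1
    have h2 := smul_left_injective ℝ hv h1
    have h3 : c * (θ (c • v) - c * θ v) = 0 := by linear_combination -h2
    have h4 := (mul_eq_zero.1 h3).resolve_left hc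
    linarith
  have hadd : ∀ u v, θ (u + v) = θ u + θ v := by
    intro u v
    -- For independent `u`, `v`, expand `S(u+v, u+v) + S(u-v, u-v) = 2 S(u, u) + 2 S(v, v)` and
    -- compare coefficients: `2θ(u) = θ(u+v) + θ(u-v)` and `2θ(v) = θ(u+v) - θ(u-v)`.
    by_cases hli : LinearIndependent ℝ ![u, v]
    · have h1 := hθ (u + v)
      have h2 := hθ (u - v)
      simp only [map_add, map_sub, add_apply, sub_apply, hS v u, hθ u, hθ v] at h1 h2
      have h3 : (2 * θ u - θ (u + v) - θ (u - v)) • u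
          + (2 * θ v - θ (u + v) + θ (u - v)) • v = 0 := by
        linear_combination (norm := module) h1 + h2
      have h4 := LinearIndependent.pair_iff.1 hli _ _ h3
      linarith [h4.1, h4.2]
    · rw [LinearIndependent.pair_iff] at hli
      push Not at hli
      obtain ⟨s, t, hst, hne⟩ := hli
      by_cases hs : s = 0
      · have ht : t ≠ 0 := hne hs
        have hv : v = 0 := by simpa [hs, ht] using hst
        simp [hv, hθ0 0 rfl]
      · have hu : u = (-(t / s)) • v := by
          have : s • u = -(t • v) := by rw [← add_eq_zero_iff_eq_neg]; exact hst
          rw [neg_smul, div_eq_inv_mul, mul_smul, ← smul_neg, ← this, smul_smul,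
            inv_mul_cancel₀ hs, one_smul]
        have : u + v = (-(t / s) + 1) • v := by rw [add_smul, one_smul, ← hu]
        rw [this, hsmul, hu, hsmul]
        ring
  let ℓ : E →ₗ[ℝ] ℝ := { toFun := θ, map_add' := hadd, map_smul' := hsmul }
  -- Polarisation gives `2 S(u, v) = θ(u) v + θ(v) u`, whence the half.
  refine ⟨(1 / 2 : ℝ) • LinearMap.toContinuousLinearMap ℓ, fun u v ↦ ?_⟩
  have h1 := hθ (u + v)
  simp only [map_add, add_apply, hS v u, hθ u, hθ v, hadd] at h1
  have hℓ : ∀ x, ((1 / 2 : ℝ) • LinearMap.toContinuousLinearMap ℓ) x = (1 / 2 : ℝ) * θ x :=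
    fun x ↦ rfl
  rw [hℓ, hℓ]
  linear_combination (norm := module) (1 / 2 : ℝ) • h1

variable {G : E → E →L[ℝ] E →L[ℝ] ℝ} {Ω : Set E} {y : E}

/-- Existence of geodesics with prescribed nonzero initial velocity. -/
lemma IsMetricOn.exists_geodesic (hG : IsMetricOn G Ω) (hy : y ∈ Ω) {v : E} (hv : v ≠ 0) :
    ∃ ε > 0, ∃ c : ℝ → E, c 0 = y ∧ deriv c 0 = v ∧ ContDiffOn ℝ 2 c (Set.Ioo (-ε) ε) ∧
      ∀ t ∈ Set.Ioo (-ε) ε, c t ∈ Ω ∧ deriv c t ≠ 0 ∧ DifferentiableAt ℝ c t ∧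
        DifferentiableAt ℝ (deriv c) t ∧
        deriv (deriv c) t + leviCivita G (c t) (deriv c t) (deriv c t) = 0 := by
  -- The geodesic equation as a first-order system for position and velocity. The time interval is
  -- later shrunk so that the position stays in `Ω` and the velocity stays nonzero.
  let F : E × E → E × E := fun z ↦ (z.2, -(leviCivita G z.1 z.2 z.2))
  have hF : ContDiffAt ℝ 1 F (y, v) := by
    have h1 : ContDiffAt ℝ 1 (fun z : E × E ↦ leviCivita G z.1) (y, v) :=
      ContDiffAt.comp (y, v) ((hG.contDiffAt_leviCivita hy).of_le (by simp)) contDiffAt_fst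
    exact contDiffAt_snd.prodMk ((h1.clm_apply contDiffAt_snd).clm_apply contDiffAt_snd).neg
  obtain ⟨α, hα0, ε₀, hε₀, hα⟩ :=
    hF.exists_forall_mem_closedBall_exists_eq_forall_mem_Ioo_hasDerivAt₀ 0
  simp only [zero_sub, zero_add] at hα
  have hmem0 : (0 : ℝ) ∈ Set.Ioo (-ε₀) ε₀ := ⟨by linarith, hε₀⟩
  have hcont : ContinuousAt α 0 := (hα 0 hmem0).continuousAt
  have hev : ∀ᶠ t in 𝓝 (0 : ℝ), (α t).1 ∈ Ω ∧ (α t).2 ≠ 0 := by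
    refine (hcont.fst.eventually_mem ?_).and (hcont.snd.eventually_ne ?_)
    · rw [hα0]; exact hG.isOpen.mem_nhds hy
    · rwa [hα0]
  obtain ⟨ε₁, hε₁, hev⟩ := Metric.eventually_nhds_iff.1 hev
  have hc : ∀ t ∈ Set.Ioo (-ε₀) ε₀, HasDerivAt (fun s ↦ (α s).1) (α t).2 t :=
    fun t ht ↦ (hα t ht).fst
  have hd : ∀ t ∈ Set.Ioo (-ε₀) ε₀,
      HasDerivAt (fun s ↦ (α s).2) (-(leviCivita G (α t).1 (α t).2 (α t).2)) t :=
    fun t ht ↦ (hα t ht).snd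
  have hderiv : ∀ t ∈ Set.Ioo (-ε₀) ε₀, deriv (fun s ↦ (α s).1) t = (α t).2 :=
    fun t ht ↦ (hc t ht).deriv
  have hderiv' : ∀ t ∈ Set.Ioo (-ε₀) ε₀, deriv (fun s ↦ (α s).1) =ᶠ[𝓝 t] fun s ↦ (α s).2 :=
    fun t ht ↦ by filter_upwards [isOpen_Ioo.mem_nhds ht] with s hs using hderiv s hs
  have hsub : Set.Ioo (-min ε₀ ε₁) (min ε₀ ε₁) ⊆ Set.Ioo (-ε₀) ε₀ :=
    Set.Ioo_subset_Ioo (by simp) (by simp)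
  have hgood : ∀ t ∈ Set.Ioo (-min ε₀ ε₁) (min ε₀ ε₁), (α t).1 ∈ Ω ∧ (α t).2 ≠ 0 := by
    intro t ht
    refine hev ?_
    rw [Real.dist_eq, sub_zero, abs_lt]
    exact ⟨by linarith [ht.1, min_le_right ε₀ ε₁], ht.2.trans_le (min_le_right _ _)⟩
  refine ⟨min ε₀ ε₁, lt_min hε₀ hε₁, fun s ↦ (α s).1, by simp [hα0], by
    rw [hderiv 0 hmem0, hα0], ?_, fun t ht ↦ ⟨(hgood t ht).1, ?_, (hc t (hsub ht)).differentiableAt,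
      ((hd t (hsub ht)).congr_of_eventuallyEq (hderiv' t (hsub ht))).differentiableAt, ?_⟩⟩
  · have hd1 : ContDiffOn ℝ 1 (fun s ↦ (α s).2) (Set.Ioo (-min ε₀ ε₁) (min ε₀ ε₁)) := by
      rw [show (1 : WithTop ℕ∞) = 0 + 1 from rfl, contDiffOn_succ_iff_deriv_of_isOpen isOpen_Ioo]
      refine ⟨fun t ht ↦ (hd t (hsub ht)).differentiableAt.differentiableWithinAt, by simp, ?_⟩
      rw [contDiffOn_zero]
      refine ContinuousOn.congr (f := fun t ↦ -(leviCivita G (α t).1 (α t).2 (α t).2)) ?_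
        fun t ht ↦ (hd t (hsub ht)).deriv
      intro t ht
      have hαt : ContinuousAt α t := (hα t (hsub ht)).continuousAt
      have h1 : ContinuousAt (fun t ↦ leviCivita G (α t).1) t :=
        ContinuousAt.comp (f := fun t ↦ (α t).1)
          (hG.contDiffAt_leviCivita (hgood t ht).1).continuousAt hαt.fst
      exact ((h1.clm_apply hαt.snd).clm_apply hαt.snd).neg.continuousWithinAt
    rw [show (2 : WithTop ℕ∞) = 1 + 1 from rfl, contDiffOn_succ_iff_deriv_of_isOpen isOpen_Ioo]
    refine ⟨fun t ht ↦ (hc t (hsub ht)).differentiableAt.differentiableWithinAt, by simp, ?_⟩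
    exact hd1.congr fun t ht ↦ hderiv t (hsub ht)
  · rw [hderiv t (hsub ht)]
    exact (hgood t ht).2
  · rw [(hderiv' t (hsub ht)).deriv_eq, (hd t (hsub ht)).deriv, hderiv t (hsub ht)]
    simp

/-- The zeros of a parallel vector field form an open set. -/
lemma IsMetricOn.eventually_eq_zero_of_cov_eq_zero (hG : IsMetricOn G Ω) (hy : y ∈ Ω) {φ : E → E}
    (hφ : ∀ z ∈ Ω, DifferentiableAt ℝ φ z) (hcov : ∀ z ∈ Ω, cov G φ z = 0) (h0 : φ y = 0) :
    ∀ᶠ z in 𝓝 y, φ z = 0 := by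
  have hK : ∀ᶠ z in 𝓝 y, ‖leviCivita G z‖ < ‖leviCivita G y‖ + 1 :=
    (hG.contDiffAt_leviCivita hy).continuousAt.norm.eventually_lt_const (by linarith)
  obtain ⟨r, hr, hball⟩ := Metric.eventually_nhds_iff_ball.1 (hK.and (hG.isOpen.mem_nhds hy))
  filter_upwards [Metric.ball_mem_nhds y hr] with z hz
  set K := ‖leviCivita G y‖ + 1
  have hseg : ∀ t ∈ Set.Icc (0 : ℝ) 1, y + t • (z - y) ∈ Metric.ball y r := by
    intro t ht
    rw [Metric.mem_ball, dist_eq_norm] at hz ⊢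
    rw [add_sub_cancel_left, norm_smul, Real.norm_of_nonneg ht.1]
    nlinarith [norm_nonneg (z - y), ht.2]
  have hder : ∀ t ∈ Set.Icc (0 : ℝ) 1, HasDerivAt (fun t : ℝ ↦ φ (y + t • (z - y)))
      (-(leviCivita G (y + t • (z - y)) (z - y) (φ (y + t • (z - y))))) t := by
    intro t ht
    have hΩ := (hball _ (hseg t ht)).2
    have h1 : HasDerivAt (fun t : ℝ ↦ y + t • (z - y)) (z - y) t := by
      simpa using ((hasDerivAt_id t).smul_const (z - y)).const_add y
    have h2 := (hφ _ hΩ).hasFDerivAt.comp_hasDerivAt t h1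
    have h3 := DFunLike.congr_fun (hcov _ hΩ) (z - y)
    rw [cov_apply, zero_apply] at h3
    rwa [eq_neg_of_add_eq_zero_left h3] at h2
  -- Along the segment from `y` to `z` a parallel field solves a linear homogeneous equation with
  -- coefficients bounded by `K * ‖z - y‖`, so Grönwall's inequality propagates the value `0`.
  have := eq_zero_of_abs_deriv_le_mul_abs_self_of_eq_zero_right (a := 0) (b := 1)
    (K := K * ‖z - y‖) (f := fun t : ℝ ↦ φ (y + t • (z - y)))
    (fun t ht ↦ (hder t ht).continuousAt.continuousWithinAt)
    (fun t ht ↦ (hder t (Set.Ico_subset_Icc_self ht)).hasDerivWithinAt) (by simpa using h0)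
    (fun t ht ↦ by
      rw [norm_neg]
      refine (ContinuousLinearMap.le_opNorm₂ _ _ _).trans ?_
      have := (hball _ (hseg t (Set.Ico_subset_Icc_self ht))).1.le
      gcongr) 1 (by simp)
  simpa using this

end LocalGeometry

/-! ### The Sinyukov equation for a pair of projectively related metrics. -/

namespace LocalGeometry

variable {E : Type*} [NormedAddCommGroup E] [NormedSpace ℝ E]

/-- The trace of an endomorphism, as a continuous linear form. -/
def traceL (E : Type*) [NormedAddCommGroup E] [NormedSpace ℝ E] [FiniteDimensional ℝ E] :
    (E →L[ℝ] E) →L[ℝ] ℝ :=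
  LinearMap.toContinuousLinearMap ((LinearMap.trace ℝ E).comp (ContinuousLinearMap.coeLM ℝ))

/-- The determinant of a continuous endomorphism. -/
def detL (A : E →L[ℝ] E) : ℝ := LinearMap.det (A : E →ₗ[ℝ] E)

lemma detL_comp (A B : E →L[ℝ] E) : detL (A.comp B) = detL A * detL B :=
  LinearMap.det_comp _ _

lemma detL_ne_zero {A : E →L[ℝ] E} (hA : A.IsInvertible) : detL A ≠ 0 := by
  obtain ⟨e, rfl⟩ := hA
  exact (LinearEquiv.isUnit_det' e.toLinearEquiv).ne_zero

lemma detL_conj (A : E →L[ℝ] E) (e : E ≃L[ℝ] E) :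
    detL ((e : E →L[ℝ] E).comp (A.comp (e.symm : E →L[ℝ] E))) = detL A :=
  LinearMap.det_conj (A : E →ₗ[ℝ] E) e.toLinearEquiv

/-- The endomorphism relating two bilinear forms: `C (relEndo B C x) = B x`. -/
def relEndo (B C : E →L[ℝ] E →L[ℝ] ℝ) : E →L[ℝ] E := C.inverse.comp B

/-- The scale factor `|det (C⁻¹ B)| ^ (-1 / (n + 1))`. -/
def projScale (B C : E →L[ℝ] E →L[ℝ] ℝ) : ℝ :=
  Real.exp (-(1 / (Module.finrank ℝ E + 1 : ℝ)) * Real.log (detL (relEndo B C)))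

lemma projScale_pos (B C : E →L[ℝ] E →L[ℝ] ℝ) : 0 < projScale B C := Real.exp_pos _

variable [FiniteDimensional ℝ E]

lemma traceL_conj (A : E →L[ℝ] E) (e : E ≃L[ℝ] E) :
    traceL E ((e : E →L[ℝ] E).comp (A.comp (e.symm : E →L[ℝ] E))) = traceL E A :=
  LinearMap.trace_conj' (A : E →ₗ[ℝ] E) e.toLinearEquiv

lemma traceL_comp_comm (A B : E →L[ℝ] E) : traceL E (A.comp B) = traceL E (B.comp A) :=
  LinearMap.trace_comp_comm' (B : E →ₗ[ℝ] E) (A : E →ₗ[ℝ] E)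

/-- Covers both traces needed below: that of `A⁻¹ ∇_v A`, which gives the derivative of the scale
factor, and that of `∇_v a`, which identifies `λ` as a gradient. -/
lemma traceL_eq_of_apply {A : E →L[ℝ] E} {c : ℝ} {α β : E →L[ℝ] ℝ} {v w : E}
    (h : ∀ x, A x = c • x + α x • v + β x • w) :
    traceL E A = c * Module.finrank ℝ E + α v + β w := by
  have : (A : E →ₗ[ℝ] E) = c • LinearMap.id + (α : E →ₗ[ℝ] ℝ).smulRight v
      + (β : E →ₗ[ℝ] ℝ).smulRight w := by
    ext x
    simpa using h x
  change LinearMap.trace ℝ E (A : E →ₗ[ℝ] E) = _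
  rw [this, map_add, map_add, map_smul, LinearMap.trace_id, LinearMap.trace_smulRight,
    LinearMap.trace_smulRight]
  rfl

lemma contDiff_detL : ContDiff ℝ ∞ (detL : (E →L[ℝ] E) → ℝ) := by
  let b := Module.finBasis ℝ E
  have h : (detL : (E →L[ℝ] E) → ℝ) = fun A ↦
      ∑ σ : Equiv.Perm (Fin (Module.finrank ℝ E)), ((Equiv.Perm.sign σ : ℤ) : ℝ) *
        ∏ i, LinearMap.toContinuousLinearMap (b.coord (σ i)) (A (b i)) := by
    ext A
    rw [detL, ← LinearMap.det_toMatrix b, Matrix.det_apply']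
    simp [LinearMap.toMatrix_apply]
  rw [h]
  refine ContDiff.sum fun σ _ ↦ contDiff_const.mul (contDiff_prod fun i _ ↦ ?_)
  exact (ContinuousLinearMap.contDiff _).comp (contDiff_id.clm_apply contDiff_const)

lemma hasDerivAt_detL_one_add_smul (A : E →L[ℝ] E) :
    HasDerivAt (fun t : ℝ ↦ detL (ContinuousLinearMap.id ℝ E + t • A)) (traceL E A) 0 := by
  let b := Module.finBasis ℝ E
  set M := LinearMap.toMatrix b b (A : E →ₗ[ℝ] E)
  have h : (fun t : ℝ ↦ detL (ContinuousLinearMap.id ℝ E + t • A)) =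
      fun t ↦ Matrix.det (1 + t • M) := by
    ext t
    rw [detL, ← LinearMap.det_toMatrix b]
    simp [M]
  have htr : traceL E A = Matrix.trace M := LinearMap.trace_eq_matrix_trace ℝ b (A : E →ₗ[ℝ] E)
  rw [h, htr, funext fun t ↦ Matrix.det_one_add_smul t M]
  -- The remainder of the determinant after its linear part is `t² P(t)`, which does not contribute
  -- to the derivative at `0`.
  set P := (Matrix.det (1 + (Polynomial.X : Polynomial ℝ) • M.map Polynomial.C)).divX.divX
  have h1 : HasDerivAt (fun t : ℝ ↦ 1 + M.trace * t) (M.trace * 1) 0 :=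
    ((hasDerivAt_id (0 : ℝ)).const_mul M.trace).const_add 1
  have h2 := (P.hasDerivAt 0).mul (hasDerivAt_pow 2 (0 : ℝ))
  exact (h1.add h2).congr_deriv (by simp)

/-- Jacobi's formula for the derivative of the determinant. -/
lemma fderiv_detL_apply {A : E →L[ℝ] E} (hA : A.IsInvertible) (M : E →L[ℝ] E) :
    fderiv ℝ detL A M = detL A * traceL E (A.inverse.comp M) := by
  have h1 : HasDerivAt (fun t : ℝ ↦ A + t • M) M 0 := by
    simpa using ((hasDerivAt_id (0 : ℝ)).smul_const M).const_add A
  have h2 := ((contDiff_detL (E := E)).differentiable (by simp)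
    (A + (0 : ℝ) • M)).hasFDerivAt.comp_hasDerivAt (0 : ℝ) h1
  have h3 : (detL ∘ fun t : ℝ ↦ A + t • M) =
      fun t ↦ detL A * detL (ContinuousLinearMap.id ℝ E + t • A.inverse.comp M) := by
    ext t
    rw [← detL_comp, Function.comp_apply]
    congr 1
    obtain ⟨e, rfl⟩ := hA
    ext x
    simp
  rw [h3, zero_smul, add_zero] at h2
  exact h2.unique ((hasDerivAt_detL_one_add_smul _).const_mul _)

/-- The covariant differential of the endomorphism field `a`. -/
def covEndo (G : E → E →L[ℝ] E →L[ℝ] ℝ) (a : E → E →L[ℝ] E) (y v x : E) : E :=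
  fderiv ℝ a y v x + leviCivita G y v (a y x) - a y (leviCivita G y v x)

/-- The endomorphism solving the Sinyukov equation of a pair of projectively related metrics. -/
def projEndo (B C : E →L[ℝ] E →L[ℝ] ℝ) : E →L[ℝ] E := projScale B C • relEndo B C

section Forms

variable {B C : E →L[ℝ] E →L[ℝ] ℝ}

lemma apply_relEndo (hC : IsMetricForm C) (x z : E) : C (relEndo B C x) z = B x z :=
  DFunLike.congr_fun (hC.apply_inverse (B x)) z

lemma isInvertible_relEndo (hB : IsMetricForm B) (hC : IsMetricForm C) :
    (relEndo B C).IsInvertible := by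
  obtain ⟨e, he⟩ := hB.isInvertible
  obtain ⟨f, hf⟩ := hC.isInvertible
  refine ⟨e.trans f.symm, ?_⟩
  rw [relEndo, ← he, ← hf]
  ext x
  simp

lemma isInvertible_projEndo (hB : IsMetricForm B) (hC : IsMetricForm C) :
    (projEndo B C).IsInvertible := by
  obtain ⟨e, he⟩ := isInvertible_relEndo hB hC
  refine ⟨e.trans (ContinuousLinearEquiv.smulLeft (Units.mk0 _ (projScale_pos B C).ne')), ?_⟩
  rw [projEndo, ← he]
  ext x
  simp

/-- With `A = relEndo B C`, both sides equal the scale factor times `C(Ax, Az)`. -/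
lemma projEndo_selfAdjoint (hB : IsMetricForm B) (hC : IsMetricForm C) (x z : E) :
    B (projEndo B C x) z = B x (projEndo B C z) := by
  have h : B (relEndo B C x) z = B x (relEndo B C z) := by
    rw [hB.symm, ← apply_relEndo hC z, ← apply_relEndo hC x, hC.symm]
  simp [projEndo, h]

/-- A change of basis conjugates the endomorphism and so preserves its determinant. Hence the scale
factor computed in coordinates is a function on the manifold, and the Sinyukov solution is an
endomorphism field. -/
lemma relEndo_bilinearComp (hC : IsMetricForm C) (e : E ≃L[ℝ] E) :
    relEndo (B.bilinearComp (e : E →L[ℝ] E) (e : E →L[ℝ] E))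
      (C.bilinearComp (e : E →L[ℝ] E) (e : E →L[ℝ] E)) =
      (e.symm : E →L[ℝ] E).comp ((relEndo B C).comp (e : E →L[ℝ] E)) := by
  ext x
  refine (hC.bilinearComp (L := (e : E →L[ℝ] E)) ⟨e, rfl⟩).ext fun w ↦ ?_
  rw [apply_relEndo (hC.bilinearComp (L := (e : E →L[ℝ] E)) ⟨e, rfl⟩)]
  simp [apply_relEndo hC]

lemma projScale_bilinearComp (hC : IsMetricForm C) (e : E ≃L[ℝ] E) :
    projScale (B.bilinearComp (e : E →L[ℝ] E) (e : E →L[ℝ] E))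
      (C.bilinearComp (e : E →L[ℝ] E) (e : E →L[ℝ] E)) = projScale B C := by
  rw [projScale, relEndo_bilinearComp hC, projScale]
  congr 3
  exact detL_conj (relEndo B C) e.symm

lemma projEndo_bilinearComp (hC : IsMetricForm C) (e : E ≃L[ℝ] E) :
    projEndo (B.bilinearComp (e : E →L[ℝ] E) (e : E →L[ℝ] E))
      (C.bilinearComp (e : E →L[ℝ] E) (e : E →L[ℝ] E)) =
      (e.symm : E →L[ℝ] E).comp ((projEndo B C).comp (e : E →L[ℝ] E)) := by
  rw [projEndo, projScale_bilinearComp hC, relEndo_bilinearComp hC, projEndo]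
  ext x
  simp

end Forms

/-- `λ = grad (½ tr a)`, where `a` is the endomorphism field of the pair of metrics `G`, `H`. -/
def projGrad (G H : E → E →L[ℝ] E →L[ℝ] ℝ) (y : E) : E :=
  (G y).inverse (fderiv ℝ (fun z ↦ (1 / 2 : ℝ) * traceL E (projEndo (G z) (H z))) y)

section Pair

variable {G H : E → E →L[ℝ] E →L[ℝ] ℝ} {Ω : Set E} {y : E}

lemma contDiffAt_relEndo (hG : IsMetricOn G Ω) (hH : IsMetricOn H Ω) (hy : y ∈ Ω) :
    ContDiffAt ℝ ∞ (fun z ↦ relEndo (G z) (H z)) y :=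
  (((hH.isMetricForm y hy).isInvertible.contDiffAt_map_inverse (n := ∞)).comp y
    (hH.contDiffAt hy)).clm_comp (hG.contDiffAt hy)

lemma contDiffAt_projScale (hG : IsMetricOn G Ω) (hH : IsMetricOn H Ω) (hy : y ∈ Ω) :
    ContDiffAt ℝ ∞ (fun z ↦ projScale (G z) (H z)) y := by
  refine ContDiffAt.exp (contDiffAt_const.mul (ContDiffAt.log ?_ ?_))
  · exact contDiff_detL.contDiffAt.comp y (contDiffAt_relEndo hG hH hy)
  · exact detL_ne_zero (isInvertible_relEndo (hG.isMetricForm y hy) (hH.isMetricForm y hy))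

lemma contDiffAt_projEndo (hG : IsMetricOn G Ω) (hH : IsMetricOn H Ω) (hy : y ∈ Ω) :
    ContDiffAt ℝ ∞ (fun z ↦ projEndo (G z) (H z)) y :=
  (contDiffAt_projScale hG hH hy).smul (contDiffAt_relEndo hG hH hy)

lemma contDiffAt_trace_projEndo (hG : IsMetricOn G Ω) (hH : IsMetricOn H Ω) (hy : y ∈ Ω) :
    ContDiffAt ℝ ∞ (fun z ↦ (1 / 2 : ℝ) * traceL E (projEndo (G z) (H z))) y :=
  contDiffAt_const.mul ((traceL E).contDiff.contDiffAt.comp y (contDiffAt_projEndo hG hH hy))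

lemma contDiffAt_projGrad (hG : IsMetricOn G Ω) (hH : IsMetricOn H Ω) (hy : y ∈ Ω) :
    ContDiffAt ℝ ∞ (projGrad G H) y :=
  (((hG.isMetricForm y hy).isInvertible.contDiffAt_map_inverse (n := ∞)).comp y
    (hG.contDiffAt hy)).clm_apply
      ((contDiffAt_trace_projEndo hG hH hy).fderiv_right (m := ∞) (by simp))

variable {ψ : E →L[ℝ] ℝ}

/-- Differentiate `H(Ax, z) = G(x, z)` and insert the expression of the Christoffel symbols of `H`
through those of `G`: only the terms in `ψ` remain. -/
lemma covEndo_relEndo (hG : IsMetricOn G Ω) (hH : IsMetricOn H Ω) (hy : y ∈ Ω)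
    (hψ : ∀ u v, leviCivita H y u v = leviCivita G y u v + ψ u • v + ψ v • u) (v x : E) :
    covEndo G (fun z ↦ relEndo (G z) (H z)) y v x =
      (-2 * ψ v) • relEndo (G y) (H y) x - ψ (relEndo (G y) (H y) x) • v
        - G y x v • (H y).inverse ψ := by
  set A := fun z ↦ relEndo (G z) (H z)
  have hA : DifferentiableAt ℝ A y := (contDiffAt_relEndo hG hH hy).differentiableAt (by simp)
  have hHy := hH.isMetricForm y hy
  have hGy := hG.isMetricForm y hy
  change _ = (-2 * ψ v) • A y x - ψ (A y x) • v - G y x v • (H y).inverse ψ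
  refine hHy.ext fun z ↦ ?_
  have hev : (fun w ↦ H w (A w x) z) =ᶠ[𝓝 y] fun w ↦ G w x z := by
    filter_upwards [hG.isOpen.mem_nhds hy] with w hw using apply_relEndo (hH.isMetricForm w hw) x z
  have h1 := ((hH.differentiableAt hy).hasFDerivAt.clm_apply
    (hA.hasFDerivAt.clm_apply (hasFDerivAt_const x y))).clm_apply (hasFDerivAt_const z y)
  have h2 := ((hG.differentiableAt hy).hasFDerivAt.clm_apply (hasFDerivAt_const x y)).clm_apply
    (hasFDerivAt_const z y)
  have h3 := DFunLike.congr_fun (h1.unique (h2.congr_of_eventuallyEq hev)) v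
  simp [hH.fderiv_eq_leviCivita hy, hG.fderiv_eq_leviCivita hy, hψ] at h3
  have h4 : ∀ w z, H y (A y w) z = G y w z := fun w z ↦ apply_relEndo hHy w z
  have h5 : H y ((H y).inverse ψ) z = ψ z := DFunLike.congr_fun (hHy.apply_inverse ψ) z
  simp only [covEndo, map_add, map_sub, map_smul, add_apply, sub_apply, smul_apply, h4, h5,
    smul_eq_mul] at h3 ⊢
  linear_combination h3

/-- By Jacobi's formula `d log |det A|` is `tr(A⁻¹ ∇A) = -2(n+1) ψ`; the exponent `-1/(n+1)` of the
scale factor is chosen to turn this into `2ψ`. In `projScale`, `Real.log` takes the absolute value,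
so the signatures play no role. -/
lemma fderiv_projScale (hG : IsMetricOn G Ω) (hH : IsMetricOn H Ω) (hy : y ∈ Ω)
    (hψ : ∀ u v, leviCivita H y u v = leviCivita G y u v + ψ u • v + ψ v • u) (v : E) :
    fderiv ℝ (fun z ↦ projScale (G z) (H z)) y v = 2 * ψ v * projScale (G y) (H y) := by
  set A := fun z ↦ relEndo (G z) (H z)
  have hA : DifferentiableAt ℝ A y := (contDiffAt_relEndo hG hH hy).differentiableAt (by simp)
  have hHy := hH.isMetricForm y hy
  have hGy := hG.isMetricForm y hy
  have hinv : (A y).IsInvertible := isInvertible_relEndo hGy hHy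
  have hdet := detL_ne_zero hinv
  -- Conjugation invariance of the trace lets the covariant derivative replace the partial one. In
  -- `covEndo_relEndo` the multiple of `A` contributes `-2nψ(v)` and each rank-one term `-ψ(v)`.
  have htr : traceL E ((A y).inverse.comp (fderiv ℝ A y v)) =
      -2 * (Module.finrank ℝ E + 1) * ψ v := by
    set Γ := leviCivita G y v
    have h1 : (A y).inverse.comp (fderiv ℝ A y v + Γ.comp (A y) - (A y).comp Γ) =
        (A y).inverse.comp (fderiv ℝ A y v) + ((A y).inverse.comp (Γ.comp (A y))) - Γ := by
      obtain ⟨e, he⟩ := hinv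
      rw [← he]
      ext x
      simp
    have h2 : traceL E ((A y).inverse.comp (Γ.comp (A y))) = traceL E Γ := by
      obtain ⟨e, he⟩ := hinv
      rw [← he]
      simpa using traceL_conj Γ e.symm
    have hAinv : ∀ x, (A y).inverse (A y x) = x := by
      obtain ⟨e, he⟩ := hinv
      rw [← he]
      simp
    have h3 := traceL_eq_of_apply
      (A := (A y).inverse.comp (fderiv ℝ A y v + Γ.comp (A y) - (A y).comp Γ))
      (c := -2 * ψ v) (α := -(ψ.comp (A y))) (β := -(G y).flip v) (v := (A y).inverse v)
      (w := (A y).inverse ((H y).inverse ψ)) (fun x ↦ by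
        have := covEndo_relEndo hG hH hy hψ v x
        have h4 : (fderiv ℝ A y v + Γ.comp (A y) - (A y).comp Γ) x = covEndo G A y v x := rfl
        rw [ContinuousLinearMap.comp_apply, h4, this, map_sub, map_sub, map_smul, map_smul,
          map_smul, hAinv]
        simp [sub_eq_add_neg, A])
    have h5 : A y ((A y).inverse v) = v := by
      obtain ⟨e, he⟩ := hinv
      rw [← he]
      simp
    have h6 : G y ((A y).inverse ((H y).inverse ψ)) v = ψ v := by
      have h7 : A y ((A y).inverse ((H y).inverse ψ)) = (H y).inverse ψ := by
        obtain ⟨e, he⟩ := hinv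
        rw [← he]
        simp
      rw [← apply_relEndo (B := G y) hHy]
      change H y (A y _) v = _
      rw [h7, hHy.apply_inverse]
    rw [h1, map_sub, map_add, h2, add_sub_cancel_right] at h3
    rw [h3]
    simp [h5, h6]
    ring
  have hd : HasFDerivAt (fun z ↦ detL (A z)) ((fderiv ℝ detL (A y)).comp (fderiv ℝ A y)) y :=
    ((contDiff_detL.differentiable (by simp)) (A y)).hasFDerivAt.comp y hA.hasFDerivAt
  have hs := ((hd.log hdet).const_mul (-(1 / (Module.finrank ℝ E + 1 : ℝ)))).exp
  have hs' : fderiv ℝ (fun z ↦ projScale (G z) (H z)) y = _ := hs.fderiv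
  rw [hs']
  have hn : (Module.finrank ℝ E + 1 : ℝ) ≠ 0 := by positivity
  simp only [smul_apply, ContinuousLinearMap.comp_apply, fderiv_detL_apply hinv, htr, smul_eq_mul]
  change projScale (G y) (H y) * _ = _
  field_simp

/-- The Sinyukov equation, together with the behaviour of the scale factor. -/
lemma exists_sinyukov (hG : IsMetricOn G Ω) (hH : IsMetricOn H Ω) (hy : y ∈ Ω)
    (hψ : ∀ u v, leviCivita H y u v = leviCivita G y u v + ψ u • v + ψ v • u) :
    (∀ v x, covEndo G (fun z ↦ projEndo (G z) (H z)) y v x =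
      G y (projGrad G H y) x • v + G y x v • projGrad G H y) ∧
    ∀ x, ψ (projEndo (G y) (H y) x) = -G y (projGrad G H y) x := by
  set A := fun z ↦ relEndo (G z) (H z)
  set s := fun z ↦ projScale (G z) (H z)
  have hA : DifferentiableAt ℝ A y := (contDiffAt_relEndo hG hH hy).differentiableAt (by simp)
  have hs : DifferentiableAt ℝ s y := (contDiffAt_projScale hG hH hy).differentiableAt (by simp)
  have hHy := hH.isMetricForm y hy
  have hGy := hG.isMetricForm y hy
  -- In `∇(sA)` the term `ds = 2ψs` cancels `-2ψ(v) A`; the two remaining rank-one terms have the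
  -- Sinyukov form with this vector.
  set l : E := -(s y • (H y).inverse ψ)
  have hp : ∀ x, G y x ((H y).inverse ψ) = ψ (A y x) := by
    intro x
    rw [← apply_relEndo (B := G y) hHy x, hHy.symm, hHy.apply_inverse]
  have hl : ∀ x, ψ (projEndo (G y) (H y) x) = -G y l x := by
    intro x
    rw [hGy.symm]
    simp [l, projEndo, hp, A, s]
  have hcov : ∀ v x, covEndo G (fun z ↦ projEndo (G z) (H z)) y v x =
      G y l x • v + G y x v • l := by
    intro v x
    have h1 : HasFDerivAt (fun z ↦ projEndo (G z) (H z)) _ y := hs.hasFDerivAt.smul hA.hasFDerivAt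
    have h2 := covEndo_relEndo hG hH hy hψ v x
    have h3 : G y l x = -(s y * ψ (A y x)) := by
      rw [hGy.symm]
      simp [l, hp]
    have h4 : fderiv ℝ s y v = 2 * ψ v * s y := fderiv_projScale hG hH hy hψ v
    have h5 : ∀ x, projEndo (G y) (H y) x = s y • A y x := fun x ↦ rfl
    rw [h3, covEndo, h1.fderiv]
    rw [covEndo] at h2
    simp only [add_apply, smul_apply, ContinuousLinearMap.smulRight_apply, h4, h5, map_smul, l]
    linear_combination (norm := module) (s y) • h2
  -- The trace of the Sinyukov equation is `d(tr a)(v) = 2 g(l, v)`, since the commutator of `a`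
  -- with the Christoffel symbols is traceless.
  have hgrad : projGrad G H y = l := by
    refine hGy.ext fun v ↦ ?_
    rw [projGrad, hGy.apply_inverse]
    have h1 : DifferentiableAt ℝ (fun z ↦ projEndo (G z) (H z)) y :=
      (contDiffAt_projEndo hG hH hy).differentiableAt (by simp)
    have h2 := ((traceL E).hasFDerivAt.comp y h1.hasFDerivAt).const_mul (1 / 2 : ℝ)
    have h3 : fderiv ℝ (fun z ↦ (1 / 2 : ℝ) * traceL E (projEndo (G z) (H z))) y = _ := h2.fderiv
    rw [h3]
    set a := fun z ↦ projEndo (G z) (H z)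
    set Γ := leviCivita G y v
    have h4 := traceL_eq_of_apply
      (A := fderiv ℝ a y v + Γ.comp (a y) - (a y).comp Γ) (c := 0) (α := G y l)
      (β := (G y).flip v) (v := v) (w := l) (fun x ↦ by
        have h6 : (fderiv ℝ a y v + Γ.comp (a y) - (a y).comp Γ) x = covEndo G a y v x := rfl
        rw [h6, hcov]
        simp)
    rw [map_sub, map_add, traceL_comp_comm Γ, add_sub_cancel_right] at h4
    rw [smul_apply, ContinuousLinearMap.comp_apply, h4]
    simp
    ring
  rw [hgrad]
  exact ⟨hcov, hl⟩

end Pair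

end LocalGeometry

/-! ### Curvature, parallel fields and integrability conditions. -/

namespace LocalGeometry

variable {E : Type*} [NormedAddCommGroup E] [NormedSpace ℝ E]
  {G : E → E →L[ℝ] E →L[ℝ] ℝ} {Ω : Set E} {y : E}

/-- The curvature tensor `R(u, v) w` of the Levi-Civita connection. -/
def curvature (G : E → E →L[ℝ] E →L[ℝ] ℝ) (y u v w : E) : E :=
  fderiv ℝ (leviCivita G) y u v w - fderiv ℝ (leviCivita G) y v u w
    + leviCivita G y u (leviCivita G y v w) - leviCivita G y v (leviCivita G y u w)

lemma curvature_swap (u v w : E) : curvature G y u v w = -curvature G y v u w := by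
  rw [curvature, curvature]
  abel

variable [FiniteDimensional ℝ E]

namespace IsMetricOn

lemma hasFDerivAt_leviCivita (hG : IsMetricOn G Ω) (hy : y ∈ Ω) :
    HasFDerivAt (leviCivita G) (fderiv ℝ (leviCivita G) y) y :=
  ((hG.contDiffAt_leviCivita hy).differentiableAt (by simp)).hasFDerivAt

lemma fderiv_leviCivita_symm (hG : IsMetricOn G Ω) (hy : y ∈ Ω) (u v w : E) :
    fderiv ℝ (leviCivita G) y u v w = fderiv ℝ (leviCivita G) y u w v := by
  have h : ∀ v w, HasFDerivAt (fun z ↦ leviCivita G z v w) _ y := fun v w ↦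
    ((hG.hasFDerivAt_leviCivita hy).clm_apply (hasFDerivAt_const v y)).clm_apply
      (hasFDerivAt_const w y)
  have hev : (fun z ↦ leviCivita G z v w) =ᶠ[𝓝 y] fun z ↦ leviCivita G z w v := by
    filter_upwards [hG.isOpen.mem_nhds hy] with z hz using hG.leviCivita_symm hz v w
  simpa using DFunLike.congr_fun ((h v w).unique ((h w v).congr_of_eventuallyEq hev)) u

/-- The first Bianchi identity. -/
lemma curvature_bianchi (hG : IsMetricOn G Ω) (hy : y ∈ Ω) (u v w : E) :
    curvature G y u v w + curvature G y v w u + curvature G y w u v = 0 := by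
  simp only [curvature]
  rw [hG.fderiv_leviCivita_symm hy u v w, hG.fderiv_leviCivita_symm hy v w u,
    hG.fderiv_leviCivita_symm hy w u v, hG.leviCivita_symm hy v w, hG.leviCivita_symm hy u w,
    hG.leviCivita_symm hy u v]
  abel

/-- Second partial derivatives of `G(w, z)` commute. Expressed through metric compatibility, their
difference is the sum of the two curvature terms. -/
lemma curvature_skew (hG : IsMetricOn G Ω) (hy : y ∈ Ω) (u v w z : E) :
    G y (curvature G y u v w) z = -G y (curvature G y u v z) w := by
  have hsymm : ∀ u v, fderiv ℝ (fderiv ℝ fun x ↦ G x w z) y u v =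
      fderiv ℝ (fderiv ℝ fun x ↦ G x w z) y v u := by
    have : ContDiffAt ℝ ∞ (fun x ↦ G x w z) y :=
      ((hG.contDiffAt hy).clm_apply contDiffAt_const).clm_apply contDiffAt_const
    exact this.isSymmSndFDerivAt (by simpa using two_le_infty)
  have hder : ∀ u v, fderiv ℝ (fderiv ℝ fun x ↦ G x w z) y u v =
      fderiv ℝ G y u (leviCivita G y v w) z + G y (fderiv ℝ (leviCivita G) y u v w) z
      + (fderiv ℝ G y u w (leviCivita G y v z) + G y w (fderiv ℝ (leviCivita G) y u v z)) := by
    intro u v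
    have hd : DifferentiableAt ℝ (fderiv ℝ fun x ↦ G x w z) y := by
      have : ContDiffAt ℝ ∞ (fun x ↦ G x w z) y :=
        ((hG.contDiffAt hy).clm_apply contDiffAt_const).clm_apply contDiffAt_const
      exact (this.fderiv_right (m := ∞) (by simp)).differentiableAt (by simp)
    have h1 := hd.hasFDerivAt.clm_apply (hasFDerivAt_const v y)
    have hGy := (hG.differentiableAt hy).hasFDerivAt
    have hΓ := fun z ↦ ((hG.hasFDerivAt_leviCivita hy).clm_apply (hasFDerivAt_const v y)).clm_apply
      (hasFDerivAt_const z y)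
    have h2 := ((hGy.clm_apply (hΓ w)).clm_apply (hasFDerivAt_const z y)).add
      ((hGy.clm_apply (hasFDerivAt_const w y)).clm_apply (hΓ z))
    have hev : (fun x ↦ fderiv ℝ (fun x ↦ G x w z) x v) =ᶠ[𝓝 y]
        ((fun x ↦ G x (leviCivita G x v w) z) + fun x ↦ G x w (leviCivita G x v z)) := by
      filter_upwards [hG.isOpen.mem_nhds hy] with x hx
      rw [← hG.fderiv_apply₂ hx, hG.fderiv_eq_leviCivita hx]
      rfl
    have h3 := DFunLike.congr_fun (h1.unique (h2.congr_of_eventuallyEq hev)) u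
    simp at h3
    rw [h3]
    ring
  have h := hsymm u v
  rw [hder, hder] at h
  simp only [hG.fderiv_eq_leviCivita hy] at h
  have hs := (hG.isMetricForm y hy).symm
  rw [hs (curvature G y u v z)]
  simp only [curvature, map_add, map_sub, add_apply, sub_apply]
  linear_combination h

/-- The pair symmetry of the curvature tensor. -/
lemma curvature_pair_symm (hG : IsMetricOn G Ω) (hy : y ∈ Ω) (u v w z : E) :
    G y (curvature G y u v w) z = G y (curvature G y w z u) v := by
  have hb : ∀ u v w z, G y (curvature G y u v w) z + G y (curvature G y v w u) z
      + G y (curvature G y w u v) z = 0 := fun u v w z ↦ by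
    simpa using congrArg (fun x ↦ G y x z) (hG.curvature_bianchi hy u v w)
  have hs := hG.curvature_skew hy
  have ha : ∀ u v w z, G y (curvature G y u v w) z = -G y (curvature G y v u w) z :=
    fun u v w z ↦ by rw [curvature_swap]; simp
  -- The octahedron argument: the Bianchi identities for the four cyclic shifts of `u, v, w, z`,
  -- combined by skewness in each pair.
  linarith [hb u v w z, hb v w z u, hb w z u v, hb z u v w, hs u v w z, hs v w u z, hs w u v z,
    hs v w z u, hs w z v u, hs z v w u, hs w z u v, hs z u w v, hs u w z v, hs z u v w,
    hs u v z w, hs v z u w, ha u v w z, ha v w u z, ha w u v z, ha z v w u, ha w z u v, ha z u w v,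
    ha u w z v, ha v z u w, ha u z v w, ha w u z v, ha v z w u]

variable {φ : E → E}

/-- The symmetry of `D²φ` is the integrability condition of `Dφ = -Γφ`. -/
lemma curvature_apply_parallel (hG : IsMetricOn G Ω) (hy : y ∈ Ω) (hφ : ContDiffAt ℝ ∞ φ y)
    (hcov : ∀ z ∈ Ω, cov G φ z = 0) (u v : E) : curvature G y u v (φ y) = 0 := by
  have hD : ∀ z ∈ Ω, ∀ v, fderiv ℝ φ z v = -leviCivita G z v (φ z) := fun z hz v ↦
    eq_neg_of_add_eq_zero_left (DFunLike.congr_fun (hcov z hz) v)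
  have hder : ∀ u v, fderiv ℝ (fderiv ℝ φ) y u v =
      -fderiv ℝ (leviCivita G) y u v (φ y) + leviCivita G y v (leviCivita G y u (φ y)) := by
    intro u v
    have h1 := ((hφ.fderiv_right (m := ∞) (by simp)).differentiableAt
      (by simp)).hasFDerivAt.clm_apply (hasFDerivAt_const v y)
    have h2 := (((hG.hasFDerivAt_leviCivita hy).clm_apply (hasFDerivAt_const v y)).clm_apply
      (hφ.differentiableAt (by simp)).hasFDerivAt).neg
    have hev : (fun z ↦ fderiv ℝ φ z v) =ᶠ[𝓝 y] -fun z ↦ leviCivita G z v (φ z) := by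
      filter_upwards [hG.isOpen.mem_nhds hy] with z hz using hD z hz v
    have h3 := DFunLike.congr_fun (h1.unique (h2.congr_of_eventuallyEq hev)) u
    simp [hD y hy] at h3
    rw [h3]
  have hsymm : fderiv ℝ (fderiv ℝ φ) y u v = fderiv ℝ (fderiv ℝ φ) y v u :=
    hφ.isSymmSndFDerivAt (by simpa using two_le_infty) u v
  rw [hder, hder] at hsymm
  rw [curvature]
  linear_combination (norm := module) -hsymm

/-- Pair symmetry moves `φ` from the first slot to the slot on which the curvature operator acts. -/
lemma curvature_parallel_left (hG : IsMetricOn G Ω) (hy : y ∈ Ω) (hφ : ContDiffAt ℝ ∞ φ y)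
    (hcov : ∀ z ∈ Ω, cov G φ z = 0) (v w : E) : curvature G y (φ y) v w = 0 :=
  (hG.isMetricForm y hy).ext fun z ↦ by
    rw [hG.curvature_pair_symm hy, hG.curvature_apply_parallel hy hφ hcov]
    simp

/-- The Hessian of a function is symmetric. -/
lemma cov_grad_symm (hG : IsMetricOn G Ω) (hy : y ∈ Ω) {T : E → ℝ} {l : E → E}
    (hT : ContDiffAt ℝ ∞ T y) (hl : DifferentiableAt ℝ l y)
    (hTl : ∀ z ∈ Ω, G z (l z) = fderiv ℝ T z) (u v : E) :
    G y (cov G l y u) v = G y (cov G l y v) u := by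
  have h : ∀ u v, fderiv ℝ (fderiv ℝ T) y u v =
      G y (cov G l y u) v + G y (l y) (leviCivita G y u v) := by
    intro u v
    have h1 := ((hT.fderiv_right (m := ∞) (by simp)).differentiableAt
      (by simp)).hasFDerivAt.clm_apply (hasFDerivAt_const v y)
    have hev : (fun z ↦ fderiv ℝ T z v) =ᶠ[𝓝 y] fun z ↦ G z (l z) v := by
      filter_upwards [hG.isOpen.mem_nhds hy] with z hz
      rw [hTl z hz]
    have h2 := hG.fderiv_apply_apply hy hl (differentiableAt_const v) u
    rw [← hev.fderiv_eq, h1.fderiv] at h2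
    simpa [cov_apply] using h2
  have hsymm := hT.isSymmSndFDerivAt (by simpa using two_le_infty) u v
  rw [h, h, hG.leviCivita_symm hy u v] at hsymm
  linarith

/-- The integrability condition of the Sinyukov equation. -/
lemma curvature_sinyukov (hG : IsMetricOn G Ω) (hy : y ∈ Ω) {a : E → E →L[ℝ] E} {l : E → E}
    (ha : ContDiffAt ℝ ∞ a y) (hl : DifferentiableAt ℝ l y)
    (hcov : ∀ z ∈ Ω, ∀ v x, covEndo G a z v x = G z (l z) x • v + G z x v • l z) (u v x : E) :
    curvature G y u v (a y x) - a y (curvature G y u v x) =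
      G y (cov G l y u) x • v - G y (cov G l y v) x • u
        + (G y x v • cov G l y u - G y x u • cov G l y v) := by
  have hD : ∀ z ∈ Ω, ∀ v x, fderiv ℝ a z v x =
      a z (leviCivita G z v x) - leviCivita G z v (a z x) + (G z (l z) x • v + G z x v • l z) := by
    intro z hz v x
    rw [← hcov z hz, covEndo]
    abel
  -- Differentiate the Sinyukov equation once more; antisymmetrising in `u`, `v` then gives the
  -- Ricci identity for `a`.
  have hder : ∀ u v, fderiv ℝ (fderiv ℝ a) y u v x =
      fderiv ℝ a y u (leviCivita G y v x) + a y (fderiv ℝ (leviCivita G) y u v x)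
      - (fderiv ℝ (leviCivita G) y u v (a y x) + leviCivita G y v (fderiv ℝ a y u x))
      + ((G y (cov G l y u) x + G y (l y) (leviCivita G y u x)) • v
        + ((G y (leviCivita G y u x) v + G y x (leviCivita G y u v)) • l y
          + G y x v • fderiv ℝ l y u)) := by
    intro u v
    have h1 := (((ha.fderiv_right (m := ∞) (by simp)).differentiableAt
      (by simp)).hasFDerivAt.clm_apply (hasFDerivAt_const v y)).clm_apply (hasFDerivAt_const x y)
    have haD := (ha.differentiableAt (by simp)).hasFDerivAt
    have hΓ := (hG.hasFDerivAt_leviCivita hy).clm_apply (hasFDerivAt_const v y)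
    have hGy := (hG.differentiableAt hy).hasFDerivAt
    have h2 := ((haD.clm_apply (hΓ.clm_apply (hasFDerivAt_const x y))).sub
      (hΓ.clm_apply (haD.clm_apply (hasFDerivAt_const x y)))).add
      ((((hGy.clm_apply hl.hasFDerivAt).clm_apply (hasFDerivAt_const x y)).smul
        (hasFDerivAt_const v y)).add
      (((hGy.clm_apply (hasFDerivAt_const x y)).clm_apply (hasFDerivAt_const v y)).smul
        hl.hasFDerivAt))
    have hev : (fun z ↦ fderiv ℝ a z v x) =ᶠ[𝓝 y] fun z ↦ a z (leviCivita G z v x)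
        - leviCivita G z v (a z x) + (G z (l z) x • v + G z x v • l z) := by
      filter_upwards [hG.isOpen.mem_nhds hy] with z hz using hD z hz v x
    have h3 := DFunLike.congr_fun (h1.unique (h2.congr_of_eventuallyEq hev)) u
    simp [hG.fderiv_eq_leviCivita hy] at h3
    rw [h3]
    simp only [cov_apply, map_add, add_apply]
    module
  have hsymm : fderiv ℝ (fderiv ℝ a) y u v x = fderiv ℝ (fderiv ℝ a) y v u x := by
    rw [ha.isSymmSndFDerivAt (by simpa using two_le_infty) u v]
  rw [hder, hder, hG.leviCivita_symm hy v u] at hsymm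
  have hs := (hG.isMetricForm y hy).symm
  have hl' : ∀ u, fderiv ℝ l y u = cov G l y u - leviCivita G y u (l y) := fun u ↦ by
    rw [cov_apply]; abel
  simp only [hD y hy, hl', map_add, map_sub, map_smul, hG.leviCivita_symm hy v u,
    hs (leviCivita G y _ x)] at hsymm
  simp only [curvature, map_add, map_sub]
  rw [hs (l y)] at hsymm
  linear_combination (norm := module) -hsymm

/-- If there is a parallel field that does not vanish at `y`, then the vector field `λ` of a
solution of the Sinyukov equation is concircular at `y`. -/
lemma exists_cov_eq_smul (hG : IsMetricOn G Ω) (hy : y ∈ Ω) {a : E → E →L[ℝ] E} {l : E → E}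
    {T : E → ℝ} (ha : ContDiffAt ℝ ∞ a y) (hl : DifferentiableAt ℝ l y)
    (hcov : ∀ z ∈ Ω, ∀ v x, covEndo G a z v x = G z (l z) x • v + G z x v • l z)
    (hT : ContDiffAt ℝ ∞ T y) (hTl : ∀ z ∈ Ω, G z (l z) = fderiv ℝ T z)
    (hφ : ContDiffAt ℝ ∞ φ y) (hφcov : ∀ z ∈ Ω, cov G φ z = 0) (h0 : φ y ≠ 0) :
    ∃ μ : ℝ, ∀ v, cov G l y v = μ • v := by
  have hGy := hG.isMetricForm y hy
  have hL := hG.cov_grad_symm hy hT hl hTl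
  set L := cov G l y
  -- The integrability condition with `u = φ`: its curvature side vanishes because `R(φ, v) = 0`.
  have hS : ∀ v x z, G y (L (φ y)) x * G y v z + G y x v * G y (L (φ y)) z =
      G y (L v) x * G y (φ y) z + G y x (φ y) * G y (L v) z := by
    intro v x z
    have h := hG.curvature_sinyukov hy ha hl hcov (φ y) v x
    rw [hG.curvature_parallel_left hy hφ hφcov, hG.curvature_parallel_left hy hφ hφcov] at h
    have h1 := congrArg (fun w ↦ G y w z) h
    simp at h1
    linarith
  obtain ⟨w, hw⟩ : ∃ w, G y (φ y) w = 1 := by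
    by_contra hcon
    refine h0 (hGy.nondegenerate _ fun w ↦ ?_)
    by_contra hw
    exact hcon ⟨(G y (φ y) w)⁻¹ • w, by simp [hw]⟩
  -- The difference of the two sides is skew in `w`, `z` (by `hS`) and symmetric in `v`, `z` (by
  -- symmetry of the Hessian). A trilinear form with both symmetries is zero.
  have hT0 : ∀ w v z, G y (φ y) w * G y (L v) z = G y (L (φ y)) w * G y v z := by
    have hanti : ∀ w v z, (G y (φ y) w * G y (L v) z - G y (L (φ y)) w * G y v z)
        + (G y (φ y) z * G y (L v) w - G y (L (φ y)) z * G y v w) = 0 := by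
      intro w v z
      have := hS v w z
      rw [hGy.symm w v, hGy.symm w (φ y)] at this
      linarith
    have hTs : ∀ w v z, G y (φ y) w * G y (L v) z - G y (L (φ y)) w * G y v z =
        G y (φ y) w * G y (L z) v - G y (L (φ y)) w * G y z v := fun w v z ↦ by
      rw [hL v z, hGy.symm v z]
    intro w v z
    have h1 := hanti w v z
    have h2 := hanti z w v
    have h3 := hanti v z w
    linarith [hTs w v z, hTs z v w, hTs v w z]
  refine ⟨G y (L (φ y)) w, fun v ↦ hGy.ext fun z ↦ ?_⟩
  have := hT0 w v z
  rw [hw, one_mul] at this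
  simpa using this

end IsMetricOn

end LocalGeometry

/-! ### Iterates of the Sinyukov endomorphism and the concircular combination. -/

namespace LocalGeometry

variable {E : Type*} [NormedAddCommGroup E] [NormedSpace ℝ E]

lemma pow_succ_apply (a : E →L[ℝ] E) (k : ℕ) (x : E) : (a ^ (k + 1)) x = a ((a ^ k) x) := by
  rw [pow_succ']
  rfl

section Algebra

variable {B : E →L[ℝ] E →L[ℝ] ℝ} {a : E →L[ℝ] E}

lemma pow_selfAdjoint (ha : ∀ x z, B (a x) z = B x (a z)) (k : ℕ) (x z : E) :
    B ((a ^ k) x) z = B x ((a ^ k) z) := by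
  induction k generalizing x z with
  | zero => simp
  | succ k ih =>
    rw [pow_succ_apply, ha, ih, pow_succ]
    rfl

/-- The recursion satisfied by the covariant derivatives of the iterates `a ^ j φ`. -/
lemma apply_of_recursion (hB : IsMetricForm B) (ha : ∀ x z, B (a x) z = B x (a z)) {φ l v : E}
    {Z : ℕ → E} (h0 : Z 0 = 0)
    (hZ : ∀ j, Z (j + 1) = B l ((a ^ j) φ) • v + B ((a ^ j) φ) v • l + a (Z j)) {k : ℕ}
    (hl : ∀ i < k, B ((a ^ i) l) l = 0) (hφ : ∀ i < k, B ((a ^ i) φ) l = 0) :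
    B (Z k) l = 0 ∧ B (Z (k + 1)) φ = 2 * B ((a ^ k) φ) l * B φ v := by
  -- Below `k` the terms `B(l, a^j φ) v` vanish by `hφ`, so the recursion unrolls to a combination
  -- of the `a^i l`.
  have hsum : ∀ j ≤ k, Z j = ∑ i ∈ Finset.range j, B ((a ^ i) φ) v • (a ^ (j - 1 - i)) l := by
    intro j
    induction j with
    | zero => simp [h0]
    | succ j ih =>
      intro hj
      rw [hZ, ih (by lia), hB.symm l, hφ j (by lia), Finset.sum_range_succ, map_sum]
      simp only [zero_smul, zero_add, add_tsub_cancel_right, tsub_self, pow_zero]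
      rw [add_comm]
      congr 1
      refine Finset.sum_congr rfl fun i hi ↦ ?_
      rw [Finset.mem_range] at hi
      rw [map_smul, ← pow_succ_apply]
      congr 3
      lia
  refine ⟨?_, ?_⟩
  · rw [hsum k le_rfl]
    simp only [map_sum, map_smul, sum_apply, smul_apply, smul_eq_mul]
    refine Finset.sum_eq_zero fun i hi ↦ ?_
    rw [Finset.mem_range] at hi
    rw [hl _ (by lia), mul_zero]
  · have hlφ : ∀ m, B ((a ^ m) l) φ = B ((a ^ m) φ) l := fun m ↦ by
      rw [pow_selfAdjoint ha, hB.symm]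
    rw [hZ, hsum k le_rfl, map_sum]
    simp only [map_add, map_sum, map_smul, add_apply, sum_apply, smul_apply, smul_eq_mul,
      ← pow_succ_apply, hlφ]
    rw [hB.symm l ((a ^ k) φ), hB.symm v φ, hB.symm l φ]
    -- The factor `2`: the `v`-term of the recursion contributes one copy. The second copy is the
    -- `l`-term if `k = 0`, and the summand `i = 0` if `k > 0`, where `hφ` kills all other terms.
    cases k with
    | zero => simp; ring
    | succ k =>
      rw [Finset.sum_range_succ', Finset.sum_eq_zero]
      · have := hφ 0 (by lia)
        simp at this
        simp [this]
        ring
      · intro i hi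
        rw [Finset.mem_range] at hi
        rw [hφ _ (by lia), mul_zero]

/-- If all `a ^ k x` are orthogonal to `l`, so is the preimage of `x` under `a`. -/
lemma apply_eq_zero_of_pow [FiniteDimensional ℝ E] (ha : Function.Injective a) (ℓ : E →L[ℝ] ℝ)
    {x : E} (h : ∀ k, ℓ ((a ^ k) (a x)) = 0) : ℓ x = 0 := by
  let W : Submodule ℝ E := Submodule.span ℝ (Set.range fun k : ℕ ↦ (a ^ k) (a x))
  have hW : ∀ w ∈ W, ℓ w = 0 := by
    intro w hw
    have : W ≤ LinearMap.ker (ℓ : E →ₗ[ℝ] ℝ) := by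
      rw [Submodule.span_le]
      rintro _ ⟨k, rfl⟩
      exact h k
    exact this hw
  have hinv : ∀ w ∈ W, (a : E →ₗ[ℝ] E) w ∈ W := by
    intro w hw
    have : W ≤ W.comap (a : E →ₗ[ℝ] E) := by
      rw [Submodule.span_le]
      rintro _ ⟨k, rfl⟩
      exact Submodule.subset_span ⟨k + 1, pow_succ_apply a k _⟩
    exact this hw
  -- An injective map of the finite-dimensional invariant space `W` is onto, so `x`, the only
  -- preimage of `a x`, already lies in `W`.
  have hinj : Function.Injective ((a : E →ₗ[ℝ] E).restrict hinv) := fun u v huv ↦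
    Subtype.ext (ha (congrArg Subtype.val huv))
  have hmem : a x ∈ W := Submodule.subset_span ⟨0, by simp⟩
  obtain ⟨⟨w, hw⟩, hwx⟩ := LinearMap.injective_iff_surjective.1 hinj ⟨a x, hmem⟩
  have : w = x := ha (congrArg Subtype.val hwx)
  exact this ▸ hW w hw

end Algebra

variable {G : E → E →L[ℝ] E →L[ℝ] ℝ} {Ω : Set E} {y : E}

section CovRules

variable {V W : E → E} {f : E → ℝ}

lemma cov_smul (hf : DifferentiableAt ℝ f y) (hV : DifferentiableAt ℝ V y) (v : E) :
    cov G (fun z ↦ f z • V z) y v = f y • cov G V y v + fderiv ℝ f y v • V y := by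
  rw [cov_apply, cov_apply, fderiv_fun_smul hf hV]
  simp
  module

lemma cov_sub (hV : DifferentiableAt ℝ V y) (hW : DifferentiableAt ℝ W y) (v : E) :
    cov G (fun z ↦ V z - W z) y v = cov G V y v - cov G W y v := by
  rw [cov_apply, cov_apply, cov_apply, fderiv_fun_sub hV hW]
  simp
  module

lemma cov_endo_apply {a : E → E →L[ℝ] E} (ha : DifferentiableAt ℝ a y)
    (hV : DifferentiableAt ℝ V y) (v : E) :
    cov G (fun z ↦ a z (V z)) y v = covEndo G a y v (V y) + a y (cov G V y v) := by
  rw [cov_apply, cov_apply, covEndo, (ha.hasFDerivAt.clm_apply hV.hasFDerivAt).fderiv]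
  simp
  abel

end CovRules

variable [FiniteDimensional ℝ E]

/-- From a parallel field `φ` and a solution `a` of the Sinyukov equation one obtains a concircular
field. -/
lemma IsMetricOn.cov_combination (hG : IsMetricOn G Ω) (hy : y ∈ Ω) {a : E → E →L[ℝ] E}
    {l φ : E → E} {k : ℕ} (ha : DifferentiableAt ℝ a y) (hl : DifferentiableAt ℝ l y)
    (hφ : DifferentiableAt ℝ φ y) (hself : ∀ x z, G y (a y x) z = G y x (a y z))
    (hcov : ∀ v x, covEndo G a y v x = G y (l y) x • v + G y x v • l y)
    (hφcov : cov G φ y = 0)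
    (hpar : φ y ≠ 0 → cov G l y = 0 ∧ ∀ i < k, G y ((a y ^ i) (l y)) (l y) = 0)
    (hk : ∀ i < k, G y ((a y ^ i) (φ y)) (l y) = 0) (v : E) :
    cov G (fun z ↦ (2 * G z ((a z ^ k) (φ z)) (l z)) • a z (φ z)
        - G z ((a z ^ (k + 1)) (φ z)) (φ z) • l z) y v =
      (2 * G y ((a y ^ k) (φ y)) (l y) * G y (φ y) (l y)) • v := by
  have hGy := hG.isMetricForm y hy
  have hX : ∀ j, DifferentiableAt ℝ (fun z ↦ (a z ^ j) (φ z)) y := fun j ↦ (ha.pow j).clm_apply hφ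
  have hXcov : ∀ j, cov G (fun z ↦ (a z ^ (j + 1)) (φ z)) y v =
      G y (l y) ((a y ^ j) (φ y)) • v + G y ((a y ^ j) (φ y)) v • l y
        + a y (cov G (fun z ↦ (a z ^ j) (φ z)) y v) := by
    intro j
    simp only [pow_succ_apply]
    rw [cov_endo_apply ha (hX j), hcov]
  have hX0 : cov G (fun z ↦ (a z ^ 0) (φ z)) y v = 0 := by simp [hφcov]
  have hC : DifferentiableAt ℝ (fun z ↦ G z ((a z ^ k) (φ z)) (l z)) y :=
    ((hG.differentiableAt hy).clm_apply (hX k)).clm_apply hl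
  have hF : DifferentiableAt ℝ (fun z ↦ G z ((a z ^ (k + 1)) (φ z)) (φ z)) y :=
    ((hG.differentiableAt hy).clm_apply (hX (k + 1))).clm_apply hφ
  rw [cov_sub (V := fun z ↦ (2 * G z ((a z ^ k) (φ z)) (l z)) • a z (φ z))
      (W := fun z ↦ G z ((a z ^ (k + 1)) (φ z)) (φ z) • l z)
      ((hC.const_mul 2).smul (ha.clm_apply hφ)) (hF.smul hl),
    cov_smul (hC.const_mul 2) (ha.clm_apply hφ), cov_smul hF hl, cov_endo_apply ha hφ, hcov, hφcov,
    fderiv_const_mul hC, smul_apply, hG.fderiv_apply_apply hy (hX k) hl,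
    hG.fderiv_apply_apply hy (hX (k + 1)) hφ, hφcov]
  -- At a zero of `φ` every term contains `φ` or its covariant derivative, so nothing is needed
  -- about `l` there.
  by_cases h0 : φ y = 0
  · simp [h0]
  · obtain ⟨hlcov, hll⟩ := hpar h0
    -- By `h1` and `∇l = 0` the first coefficient has zero derivative. By `h2` the derivative of the
    -- second cancels the term `G(φ, v) l` coming from `∇(aφ)`. Only the multiple of `v` remains.
    obtain ⟨h1, h2⟩ := apply_of_recursion hGy hself
      (Z := fun j ↦ cov G (fun z ↦ (a z ^ j) (φ z)) y v) hX0 hXcov hll hk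
    rw [h1, h2, hlcov, hGy.symm (l y) (φ y)]
    simp
    module

end LocalGeometry

/-! ### Smooth parametrizations, vector fields and metrics read in them. -/

namespace LocalGeometry

variable {n : ℕ} {M : Type*} [TopologicalSpace M] [ChartedSpace (EuclideanSpace ℝ (Fin n)) M]

/-- The derivative of a parametrization, as an endomorphism of the model space. -/
def dParam (κ : EuclideanSpace ℝ (Fin n) → M) (y : EuclideanSpace ℝ (Fin n)) :
    EuclideanSpace ℝ (Fin n) →L[ℝ] EuclideanSpace ℝ (Fin n) :=
  mfderiv 𝓘(ℝ, EuclideanSpace ℝ (Fin n)) (𝓡 n) κ y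

/-- The derivative of a coordinate map, as an endomorphism of the model space. -/
def dCoord (k : M → EuclideanSpace ℝ (Fin n)) (x : M) :
    EuclideanSpace ℝ (Fin n) →L[ℝ] EuclideanSpace ℝ (Fin n) :=
  mfderiv (𝓡 n) 𝓘(ℝ, EuclideanSpace ℝ (Fin n)) k x

/-- A vector field read in the coordinates `k` with inverse `κ`. -/
def fieldIn (V : (x : M) → TangentSpace (𝓡 n) x) (κ : EuclideanSpace ℝ (Fin n) → M)
    (k : M → EuclideanSpace ℝ (Fin n)) (y : EuclideanSpace ℝ (Fin n)) :
    EuclideanSpace ℝ (Fin n) :=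
  dCoord k (κ y) (V (κ y))

/-- `κ` is a smooth parametrization of an open subset of `M` by the open set `Ω`, and `k` is its
inverse. -/
structure IsParam (κ : EuclideanSpace ℝ (Fin n) → M) (k : M → EuclideanSpace ℝ (Fin n))
    (Ω : Set (EuclideanSpace ℝ (Fin n))) : Prop where
  isOpen : IsOpen Ω
  isOpen_image : IsOpen (κ '' Ω)
  contMDiffOn : ContMDiffOn 𝓘(ℝ, EuclideanSpace ℝ (Fin n)) (𝓡 n) ∞ κ Ω
  contMDiffOn_inv : ContMDiffOn (𝓡 n) 𝓘(ℝ, EuclideanSpace ℝ (Fin n)) ∞ k (κ '' Ω)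
  left_inv (y : EuclideanSpace ℝ (Fin n)) (hy : y ∈ Ω) : k (κ y) = y

lemma isParam_extChartAt [IsManifold (𝓡 n) ∞ M] (p : M) :
    IsParam (extChartAt (𝓡 n) p).symm (extChartAt (𝓡 n) p) (extChartAt (𝓡 n) p).target where
  isOpen := isOpen_extChartAt_target p
  isOpen_image := by
    rw [PartialEquiv.symm_image_target_eq_source]
    exact isOpen_extChartAt_source p
  contMDiffOn := contMDiffOn_extChartAt_symm p
  contMDiffOn_inv := by
    rw [PartialEquiv.symm_image_target_eq_source, extChartAt_source]
    exact contMDiffOn_extChartAt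
  left_inv y hy := (extChartAt (𝓡 n) p).right_inv hy

namespace IsParam

variable {κ κ' : EuclideanSpace ℝ (Fin n) → M} {k k' : M → EuclideanSpace ℝ (Fin n)}
  {Ω Ω' : Set (EuclideanSpace ℝ (Fin n))} {y y' : EuclideanSpace ℝ (Fin n)}

lemma contMDiffAt (P : IsParam κ k Ω) (hy : y ∈ Ω) :
    ContMDiffAt 𝓘(ℝ, EuclideanSpace ℝ (Fin n)) (𝓡 n) ∞ κ y :=
  P.contMDiffOn.contMDiffAt (P.isOpen.mem_nhds hy)

lemma image_mem_nhds (P : IsParam κ k Ω) (hy : y ∈ Ω) : κ '' Ω ∈ 𝓝 (κ y) :=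
  P.isOpen_image.mem_nhds ⟨y, hy, rfl⟩

lemma contMDiffAt_inv (P : IsParam κ k Ω) (hy : y ∈ Ω) :
    ContMDiffAt (𝓡 n) 𝓘(ℝ, EuclideanSpace ℝ (Fin n)) ∞ k (κ y) :=
  P.contMDiffOn_inv.contMDiffAt (P.image_mem_nhds hy)

lemma mem_and_right_inv (P : IsParam κ k Ω) {x : M} (hx : x ∈ κ '' Ω) : k x ∈ Ω ∧ κ (k x) = x := by
  obtain ⟨y, hy, rfl⟩ := hx
  rw [P.left_inv y hy]
  exact ⟨hy, rfl⟩

lemma dCoord_dParam (P : IsParam κ k Ω) (hy : y ∈ Ω) :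
    (dCoord k (κ y)).comp (dParam κ y) = ContinuousLinearMap.id ℝ _ := by
  have h := ((P.contMDiffAt_inv hy).mdifferentiableAt (by simp)).hasMFDerivAt.comp y
    ((P.contMDiffAt hy).mdifferentiableAt (by simp)).hasMFDerivAt
  have hev : k ∘ κ =ᶠ[𝓝 y] id := by
    filter_upwards [P.isOpen.mem_nhds hy] with z hz using P.left_inv z hz
  exact (hasMFDerivAt_unique h ((hasMFDerivAt_id y).congr_of_eventuallyEq hev))

lemma exists_equiv (P : IsParam κ k Ω) (hy : y ∈ Ω) :
    ∃ e : EuclideanSpace ℝ (Fin n) ≃L[ℝ] EuclideanSpace ℝ (Fin n),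
      (e : EuclideanSpace ℝ (Fin n) →L[ℝ] EuclideanSpace ℝ (Fin n)) = dParam κ y ∧
      (e.symm : EuclideanSpace ℝ (Fin n) →L[ℝ] EuclideanSpace ℝ (Fin n)) = dCoord k (κ y) := by
  have h := P.dCoord_dParam hy
  have h' : (dParam κ y).comp (dCoord k (κ y)) = ContinuousLinearMap.id ℝ _ := by
    have h1 : ((dCoord k (κ y)).toLinearMap).comp (dParam κ y).toLinearMap = LinearMap.id := by
      ext v : 1
      exact DFunLike.congr_fun h v
    have h2 := (LinearMap.comp_eq_id_comm ℝ _).1 h1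
    ext v : 1
    exact DFunLike.congr_fun h2 v
  exact ⟨ContinuousLinearEquiv.equivOfInverse _ _ (fun v ↦ DFunLike.congr_fun h v)
    fun v ↦ DFunLike.congr_fun h' v, rfl, rfl⟩

lemma fieldIn_eq_iff (P : IsParam κ k Ω) (hy : y ∈ Ω) (V : (x : M) → TangentSpace (𝓡 n) x)
    (w : EuclideanSpace ℝ (Fin n)) : fieldIn V κ k y = w ↔ V (κ y) = dParam κ y w := by
  obtain ⟨e, he, he'⟩ := P.exists_equiv hy
  rw [fieldIn, ← he, ← he']
  exact e.symm_apply_eq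

/-! ### Changes of parametrization -/

/-- The facts about the change of coordinates `k' ∘ κ` needed for the transformation laws. -/
lemma transition (P : IsParam κ k Ω) (P' : IsParam κ' k' Ω') (hy : y ∈ Ω) (hy' : y' ∈ Ω')
    (hyy' : κ y = κ' y') :
    k' (κ y) = y' ∧ ContDiffAt ℝ ∞ (fun z ↦ k' (κ z)) y ∧
    ∀ᶠ z in 𝓝 y, z ∈ Ω ∧ k' (κ z) ∈ Ω' ∧ κ' (k' (κ z)) = κ z ∧
      fderiv ℝ (fun z ↦ k' (κ z)) z = (dCoord k' (κ z)).comp (dParam κ z) := by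
  have hcont : ContMDiffAt 𝓘(ℝ, EuclideanSpace ℝ (Fin n)) 𝓘(ℝ, EuclideanSpace ℝ (Fin n)) ∞
      (fun z ↦ k' (κ z)) y := by
    have h1 := P'.contMDiffAt_inv hy'
    rw [← hyy'] at h1
    exact h1.comp y (P.contMDiffAt hy)
  refine ⟨by rw [hyy', P'.left_inv y' hy'], contMDiffAt_iff_contDiffAt.1 hcont, ?_⟩
  have himg : ∀ᶠ z in 𝓝 y, κ z ∈ κ' '' Ω' :=
    (P.contMDiffAt hy).continuousAt.eventually_mem (hyy' ▸ P'.image_mem_nhds hy')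
  filter_upwards [P.isOpen.mem_nhds hy, himg] with z hz hz'
  obtain ⟨h1, h2⟩ := P'.mem_and_right_inv hz'
  refine ⟨hz, h1, h2, ?_⟩
  have h3 := P'.contMDiffAt_inv h1
  rw [h2] at h3
  have h := (h3.mdifferentiableAt (by simp)).hasMFDerivAt.comp z
    ((P.contMDiffAt hz).mdifferentiableAt (by simp)).hasMFDerivAt
  have h' : HasFDerivAt (fun z ↦ k' (κ z)) ((dCoord k' (κ z)).comp (dParam κ z)) z :=
    hasMFDerivAt_iff_hasFDerivAt.1 h
  exact h'.fderiv

lemma fderiv_transition_isInvertible (P : IsParam κ k Ω) (P' : IsParam κ' k' Ω') (hy : y ∈ Ω)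
    (hy' : y' ∈ Ω') (hyy' : κ y = κ' y') : (fderiv ℝ (fun z ↦ k' (κ z)) y).IsInvertible := by
  obtain ⟨-, -, h⟩ := P.transition P' hy hy' hyy'
  rw [h.self_of_nhds.2.2.2]
  obtain ⟨e, he, -⟩ := P.exists_equiv hy
  obtain ⟨e', -, he'⟩ := P'.exists_equiv hy'
  rw [← he, hyy', ← he']
  exact ⟨e.trans e'.symm, rfl⟩

lemma fieldIn_transition (P : IsParam κ k Ω) (P' : IsParam κ' k' Ω') (hy : y ∈ Ω) (hy' : y' ∈ Ω')
    (hyy' : κ y = κ' y') (V : (x : M) → TangentSpace (𝓡 n) x) :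
    ∀ᶠ z in 𝓝 y, fieldIn V κ' k' (k' (κ z)) =
      fderiv ℝ (fun z ↦ k' (κ z)) z (fieldIn V κ k z) := by
  obtain ⟨-, -, h⟩ := P.transition P' hy hy' hyy'
  filter_upwards [h] with z hz
  obtain ⟨h1, h2, h3, h4⟩ := hz
  obtain ⟨e, he, he'⟩ := P.exists_equiv h1
  rw [h4, fieldIn, fieldIn, h3, ContinuousLinearMap.comp_apply, ← he, ← he']
  congr 1
  exact (e.apply_symm_apply _).symm

/-! ### Smoothness of vector fields -/

variable [IsManifold (𝓡 n) ∞ M] {V : (x : M) → TangentSpace (𝓡 n) x}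

/-- The coordinate expression is the pullback of the field along `κ`, since `dCoord` inverts
`dParam`. -/
lemma contDiffAt_fieldIn (P : IsParam κ k Ω) (hy : y ∈ Ω)
    (hV : ContMDiffAt (𝓡 n) (𝓡 n).tangent ∞ (fun x ↦ (⟨x, V x⟩ : TangentBundle (𝓡 n) M)) (κ y)) :
    ContDiffAt ℝ ∞ (fieldIn V κ k) y := by
  have hinv : ∀ z ∈ Ω, (mfderiv 𝓘(ℝ, EuclideanSpace ℝ (Fin n)) (𝓡 n) κ z).inverse =
      dCoord k (κ z) := fun z hz ↦ by
    obtain ⟨e, he, he'⟩ := P.exists_equiv hz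
    change (dParam κ z).inverse = _
    rw [← he, ← he', ContinuousLinearMap.inverse_equiv]
  have hIs : (mfderiv 𝓘(ℝ, EuclideanSpace ℝ (Fin n)) (𝓡 n) κ y).IsInvertible := by
    obtain ⟨e, he, he'⟩ := P.exists_equiv hy
    exact ⟨e, he⟩
  have h := ContMDiffAt.mpullback_vectorField_preimage (n := ∞) (m := ∞) hV (P.contMDiffAt hy) hIs
    (by simp)
  rw [contMDiffAt_vectorSpace_iff_contDiffAt] at h
  refine h.congr_of_eventuallyEq ?_
  filter_upwards [P.isOpen.mem_nhds hy] with z hz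
  rw [VectorField.mpullback_apply, hinv z hz]
  rfl

lemma contMDiffAt_of_fieldIn (P : IsParam κ k Ω) (hy : y ∈ Ω)
    (hV : ContDiffAt ℝ ∞ (fieldIn V κ k) y) :
    ContMDiffAt (𝓡 n) (𝓡 n).tangent ∞ (fun x ↦ (⟨x, V x⟩ : TangentBundle (𝓡 n) M)) (κ y) := by
  have hIs : (mfderiv (𝓡 n) 𝓘(ℝ, EuclideanSpace ℝ (Fin n)) k (κ y)).IsInvertible := by
    obtain ⟨e, he, he'⟩ := P.exists_equiv hy
    exact ⟨e.symm, he'⟩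
  have hW : ContMDiffAt 𝓘(ℝ, EuclideanSpace ℝ (Fin n)) 𝓘(ℝ, EuclideanSpace ℝ (Fin n)).tangent ∞
      (fun z ↦ (⟨z, fieldIn V κ k z⟩ :
        TangentBundle 𝓘(ℝ, EuclideanSpace ℝ (Fin n)) (EuclideanSpace ℝ (Fin n)))) (k (κ y)) := by
    rw [P.left_inv y hy]
    exact contMDiffAt_vectorSpace_iff_contDiffAt.2 hV
  have h := ContMDiffAt.mpullback_vectorField_preimage (n := ∞) (m := ∞) hW (P.contMDiffAt_inv hy)
    hIs (by simp)
  refine h.congr_of_eventuallyEq ?_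
  filter_upwards [P.image_mem_nhds hy] with x hx
  obtain ⟨z, hz, rfl⟩ := hx
  congr 1
  obtain ⟨e, he, he'⟩ := P.exists_equiv hz
  change V (κ z) = (dCoord k (κ z)).inverse (fieldIn V κ k (k (κ z)))
  rw [P.left_inv z hz, fieldIn, ← he', ContinuousLinearMap.inverse_equiv]
  exact (e.apply_symm_apply _).symm

/-! ### Metrics -/

/-- The bilinear form at `x`, as a form on the model space. -/
def _root_.PseudoRiemannianMetric.formAt (g : PseudoRiemannianMetric n M) (x : M) :
    EuclideanSpace ℝ (Fin n) →L[ℝ] EuclideanSpace ℝ (Fin n) →L[ℝ] ℝ :=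
  g.form x

/-- A field of bilinear forms read in the parametrization `κ`. -/
def _root_.PseudoRiemannianMetric.formIn (g : PseudoRiemannianMetric n M)
    (κ : EuclideanSpace ℝ (Fin n) → M) (y : EuclideanSpace ℝ (Fin n)) :
    EuclideanSpace ℝ (Fin n) →L[ℝ] EuclideanSpace ℝ (Fin n) →L[ℝ] ℝ :=
  (g.formAt (κ y)).bilinearComp (dParam κ y) (dParam κ y)

lemma _root_.PseudoRiemannianMetric.isMetricForm (g : PseudoRiemannianMetric n M) (x : M) :
    IsMetricForm (g.formAt x) :=
  ⟨g.symm x, g.nondegenerate x⟩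

lemma contMDiffOn_dParam_const (P : IsParam κ k Ω) (u : EuclideanSpace ℝ (Fin n)) :
    ContMDiffOn 𝓘(ℝ, EuclideanSpace ℝ (Fin n)) (𝓡 n).tangent ∞
      (fun y ↦ (⟨κ y, dParam κ y u⟩ : TangentBundle (𝓡 n) M)) Ω := by
  have h := P.contMDiffOn.contMDiffOn_tangentMapWithin (m := ∞) (by simp)
    P.isOpen.uniqueMDiffOn
  have hc : ContMDiffOn 𝓘(ℝ, EuclideanSpace ℝ (Fin n)) 𝓘(ℝ, EuclideanSpace ℝ (Fin n)).tangent ∞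
      (fun z ↦ (⟨z, u⟩ :
        TangentBundle 𝓘(ℝ, EuclideanSpace ℝ (Fin n)) (EuclideanSpace ℝ (Fin n)))) Ω :=
    contMDiffOn_vectorSpace_iff_contDiffOn.2 contDiffOn_const
  refine (h.comp hc fun z hz ↦ hz).congr fun z hz ↦ ?_
  rw [Function.comp_apply, tangentMapWithin, mfderivWithin_of_isOpen P.isOpen hz]
  rfl

/-- Smoothness is tested on constant vectors `u`, `v`: the metric is evaluated on the smooth fields
`dParam κ y u` and `dParam κ y v` along `κ`. -/
lemma isMetricOn (P : IsParam κ k Ω) (g : PseudoRiemannianMetric n M) :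
    IsMetricOn (g.formIn κ) Ω where
  isOpen := P.isOpen
  contDiffOn := by
    rw [contDiffOn_clm_apply]
    intro u
    rw [contDiffOn_clm_apply]
    intro v
    have h : ContMDiffOn 𝓘(ℝ, EuclideanSpace ℝ (Fin n)) ((𝓡 n).prod 𝓘(ℝ, ℝ)) ∞
        (fun y ↦ Bundle.TotalSpace.mk' ℝ (E := Bundle.Trivial M ℝ) (κ y)
          (g.form (κ y) (dParam κ y u) (dParam κ y v))) Ω := by
      apply ContMDiffOn.clm_bundle_apply₂ (F₁ := EuclideanSpace ℝ (Fin n))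
        (F₂ := EuclideanSpace ℝ (Fin n))
      · exact g.contMDiff.comp_contMDiffOn P.contMDiffOn
      · exact P.contMDiffOn_dParam_const u
      · exact P.contMDiffOn_dParam_const v
    rw [← contMDiffOn_iff_contDiffOn]
    intro y hy
    have := h y hy
    simp only [Bundle.contMDiffWithinAt_totalSpace] at this
    exact this.2
  isMetricForm y hy := by
    obtain ⟨e, he, -⟩ := P.exists_equiv hy
    exact (g.isMetricForm (κ y)).bilinearComp ⟨e, he⟩

lemma formIn_transition (P : IsParam κ k Ω) (P' : IsParam κ' k' Ω') (hy : y ∈ Ω) (hy' : y' ∈ Ω')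
    (hyy' : κ y = κ' y') (g : PseudoRiemannianMetric n M) :
    ∀ᶠ z in 𝓝 y, g.formIn κ z = (g.formIn κ' (k' (κ z))).bilinearComp
      (fderiv ℝ (fun z ↦ k' (κ z)) z) (fderiv ℝ (fun z ↦ k' (κ z)) z) := by
  obtain ⟨-, -, h⟩ := P.transition P' hy hy' hyy'
  filter_upwards [h] with z hz
  obtain ⟨h1, h2, h3, h4⟩ := hz
  obtain ⟨e, he, he'⟩ := P'.exists_equiv h2
  have h5 : ∀ u, dParam κ' (k' (κ z)) (dCoord k' (κ z) u) = u := by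
    intro u
    rw [← h3, ← he']
    rw [P'.left_inv _ h2, ← he]
    simp
  rw [h4]
  ext u v
  simp only [PseudoRiemannianMetric.formIn, ContinuousLinearMap.bilinearComp_apply,
    ContinuousLinearMap.comp_apply, h5, h3]

end IsParam

end LocalGeometry

/-! ### Independence of the parametrization, and geodesic mappings in coordinates. -/

namespace LocalGeometry

variable {n : ℕ} {M : Type*} [TopologicalSpace M] [ChartedSpace (EuclideanSpace ℝ (Fin n)) M]
  {N : Type*} [TopologicalSpace N] [ChartedSpace (EuclideanSpace ℝ (Fin n)) N]

/-- A diffeomorphism transports parametrizations. -/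
lemma IsParam.comp_diffeomorph {κ : EuclideanSpace ℝ (Fin n) → M}
    {k : M → EuclideanSpace ℝ (Fin n)} {Ω : Set (EuclideanSpace ℝ (Fin n))} (P : IsParam κ k Ω)
    (f : M ≃ₘ^∞⟮𝓡 n, 𝓡 n⟯ N) :
    IsParam (fun y ↦ f (κ y)) (fun x ↦ k (f.symm x)) Ω where
  isOpen := P.isOpen
  isOpen_image := by
    have : (fun y ↦ f (κ y)) '' Ω = f.toHomeomorph '' (κ '' Ω) := by
      rw [Set.image_image]
      rfl
    rw [this]
    exact f.toHomeomorph.isOpenMap _ P.isOpen_image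
  contMDiffOn := f.contMDiff.comp_contMDiffOn P.contMDiffOn
  contMDiffOn_inv := by
    refine P.contMDiffOn_inv.comp f.symm.contMDiff.contMDiffOn ?_
    rintro _ ⟨y, hy, rfl⟩
    exact ⟨y, hy, by simp⟩
  left_inv y hy := by simp [P.left_inv y hy]

variable [IsManifold (𝓡 n) ∞ M] [IsManifold (𝓡 n) ∞ N]

namespace IsParam

variable {κ κ' : EuclideanSpace ℝ (Fin n) → M} {k k' : M → EuclideanSpace ℝ (Fin n)}
  {Ω Ω' : Set (EuclideanSpace ℝ (Fin n))} {y y' : EuclideanSpace ℝ (Fin n)}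

variable {V : (x : M) → TangentSpace (𝓡 n) x} {g : PseudoRiemannianMetric n M}

/-- The covariant derivative does not depend on the parametrization. -/
lemma cov_transition (P : IsParam κ k Ω) (P' : IsParam κ' k' Ω') (hy : y ∈ Ω) (hy' : y' ∈ Ω')
    (hyy' : κ y = κ' y')
    (hV : ContMDiff (𝓡 n) (𝓡 n).tangent ∞ (fun x ↦ (⟨x, V x⟩ : TangentBundle (𝓡 n) M)))
    (u : EuclideanSpace ℝ (Fin n)) :
    fderiv ℝ (fun z ↦ k' (κ z)) y (cov (g.formIn κ) (fieldIn V κ k) y u) =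
      cov (g.formIn κ') (fieldIn V κ' k') y' (fderiv ℝ (fun z ↦ k' (κ z)) y u) := by
  obtain ⟨h1, h2, h3⟩ := P.transition P' hy hy' hyy'
  have h4 := cov_pullback (P.isMetricOn g) hy (P'.isMetricOn g) (τ := fun z ↦ k' (κ z))
    (by rwa [h1]) h2 (P.fderiv_transition_isInvertible P' hy hy' hyy')
    (P.formIn_transition P' hy hy' hyy' g)
    ((P.contDiffAt_fieldIn hy hV.contMDiffAt).differentiableAt (by simp))
    (by rw [h1]; exact (P'.contDiffAt_fieldIn hy' hV.contMDiffAt).differentiableAt (by simp))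
    (P.fieldIn_transition P' hy hy' hyy' V) u
  simp only [h1] at h4
  exact h4

/-- A multiple of the identity is unchanged by conjugation, so the concircular equation at a point
may be checked in any single parametrization. -/
lemma cov_eq_smul_iff_of_transition (P : IsParam κ k Ω) (P' : IsParam κ' k' Ω') (hy : y ∈ Ω)
    (hy' : y' ∈ Ω') (hyy' : κ y = κ' y')
    (hV : ContMDiff (𝓡 n) (𝓡 n).tangent ∞ (fun x ↦ (⟨x, V x⟩ : TangentBundle (𝓡 n) M))) (r : ℝ) :
    (∀ u, cov (g.formIn κ) (fieldIn V κ k) y u = r • u) ↔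
      ∀ u, cov (g.formIn κ') (fieldIn V κ' k') y' u = r • u := by
  obtain ⟨e, he⟩ := P.fderiv_transition_isInvertible P' hy hy' hyy'
  have h := P.cov_transition P' (g := g) hy hy' hyy' hV
  rw [← he] at h
  constructor
  · intro h1 u
    have h2 := h (e.symm u)
    rw [h1] at h2
    simpa using h2.symm
  · intro h1 u
    have h2 := h u
    rw [h1] at h2
    exact e.injective (by simpa using h2)

/-- The equation of concircular fields, read in a parametrization. -/
lemma concircular_iff (P : IsParam κ k Ω) (hy : y ∈ Ω)
    (hV : ContMDiff (𝓡 n) (𝓡 n).tangent ∞ (fun x ↦ (⟨x, V x⟩ : TangentBundle (𝓡 n) M))) (r : ℝ) :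
    (∀ X Y : TangentSpace (𝓡 n) (κ y),
      g.form (κ y) (g.covDeriv V (κ y) Y) X = r * g.form (κ y) X Y) ↔
      ∀ u, cov (g.formIn κ) (fieldIn V κ k) y u = r • u := by
  rw [P.cov_eq_smul_iff_of_transition (isParam_extChartAt (κ y)) hy (mem_extChartAt_target (κ y))
    (extChartAt_to_inv (κ y)).symm hV]
  have hcov : ∀ u, cov (g.formIn (extChartAt (𝓡 n) (κ y)).symm)
      (fieldIn V (extChartAt (𝓡 n) (κ y)).symm (extChartAt (𝓡 n) (κ y)))
      (extChartAt (𝓡 n) (κ y) (κ y)) u = g.covDeriv V (κ y) u := by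
    intro u
    -- At its own centre the preferred chart has the identity as derivative.
    have h1 : fieldIn V (extChartAt (𝓡 n) (κ y)).symm (extChartAt (𝓡 n) (κ y))
        (extChartAt (𝓡 n) (κ y) (κ y)) = V (κ y) := by
      rw [fieldIn, extChartAt_to_inv, dCoord, mfderiv_extChartAt_self]
      rfl
    rw [cov_apply, h1]
    rfl
  simp only [hcov]
  constructor
  · intro h u
    refine (g.isMetricForm (κ y)).ext fun w ↦ ?_
    have h1 : g.formAt (κ y) (g.covDeriv V (κ y) u) w = r * g.formAt (κ y) w u := h w u
    rw [h1, (g.isMetricForm (κ y)).symm w u]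
    simp
  · intro h X Y
    change g.formAt (κ y) (g.covDeriv V (κ y) Y) X = r * g.formAt (κ y) X Y
    rw [(g.isMetricForm (κ y)).symm X Y]
    have h1 : g.covDeriv V (κ y) Y = (r • Y : EuclideanSpace ℝ (Fin n)) := h Y
    rw [h1]
    exact DFunLike.congr_fun ((g.formAt (κ y)).map_smul r Y) X

end IsParam

/-- A geodesic mapping changes the Christoffel symbols by `ψ ⊗ id + id ⊗ ψ`. -/
lemma exists_leviCivita_eq_of_isGeodesicMapping {g : PseudoRiemannianMetric n M}
    {g' : PseudoRiemannianMetric n N} {f : M ≃ₘ^∞⟮𝓡 n, 𝓡 n⟯ N} (hf : g.IsGeodesicMapping g' f)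
    {κ : EuclideanSpace ℝ (Fin n) → M} {k : M → EuclideanSpace ℝ (Fin n)}
    {Ω : Set (EuclideanSpace ℝ (Fin n))} (P : IsParam κ k Ω) {y : EuclideanSpace ℝ (Fin n)}
    (hy : y ∈ Ω) :
    ∃ ψ : EuclideanSpace ℝ (Fin n) →L[ℝ] ℝ, ∀ u v,
      leviCivita (g'.formIn fun y ↦ f (κ y)) y u v =
        leviCivita (g.formIn κ) y u v + ψ u • v + ψ v • u := by
  have P' := P.comp_diffeomorph f
  have hG := P.isMetricOn g
  have hG' := P'.isMetricOn g'
  obtain ⟨ψ, hψ⟩ := exists_eq_smul_add_smul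
    (leviCivita (g'.formIn fun y ↦ f (κ y)) y - leviCivita (g.formIn κ) y)
    (fun u v ↦ by simp [hG.leviCivita_symm hy u v, hG'.leviCivita_symm hy u v]) (fun v ↦ by
      by_cases hv : v = 0
      · exact ⟨0, by simp [hv]⟩
      -- An affinely parametrized geodesic of `g` with velocity `v`. Its image has the same
      -- coordinate curve `c` in the parametrization `f ∘ κ`, so subtracting the two geodesic
      -- equations at time `0` shows that the difference of the symbols on `(v, v)` is `θ v`.
      obtain ⟨ε, hε, c, hc0, hc0', hcsmooth, hc⟩ := hG.exists_geodesic hy hv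
      have hmem : ∀ t ∈ Set.Ioo (-ε) ε, Set.Ioo (-ε) ε ∈ 𝓝 t := fun t ht ↦ isOpen_Ioo.mem_nhds ht
      have hgeo : g.IsGeodesicOn (fun t ↦ κ (c t)) (Set.Ioo (-ε) ε) := by
        refine ⟨(P.contMDiffOn.of_le two_le_infty).comp hcsmooth.contMDiffOn fun t ht ↦ (hc t ht).1,
          fun t ht ↦ ?_⟩
        obtain ⟨hΩ, hne, hd, hd', heq⟩ := hc t ht
        have Q := isParam_extChartAt (n := n) (κ (c t))
        have hQ := mem_extChartAt_target (I := 𝓡 n) (κ (c t))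
        have hyy' := (extChartAt_to_inv (I := 𝓡 n) (κ (c t))).symm
        obtain ⟨h1, h2, h3⟩ := P.transition Q hΩ hQ hyy'
        have hinv := P.fderiv_transition_isInvertible Q hΩ hQ hyy'
        obtain ⟨h4, h5⟩ := acceleration_pullback hG (c := c) hΩ (Q.isMetricOn g)
          (τ := fun z ↦ extChartAt (𝓡 n) (κ (c t)) (κ z)) (by rwa [h1]) h2 hinv
          (P.formIn_transition Q hΩ hQ hyy' g)
          (by filter_upwards [hmem t ht] with s hs using (hc s hs).2.2.1) hd'
        rw [heq, map_zero] at h5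
        refine ⟨?_, 0, ?_⟩
        · rw [h4]
          obtain ⟨e, he⟩ := hinv
          rw [← he]
          simpa using hne
        · rw [zero_smul]
          exact h5
      have h0 : (0 : ℝ) ∈ Set.Ioo (-ε) ε := ⟨by linarith, hε⟩
      obtain ⟨-, hgeo'⟩ := hf _ _ isOpen_Ioo Set.ordConnected_Ioo hgeo
      obtain ⟨-, θ, hθ⟩ := hgeo' 0 h0
      obtain ⟨hΩ, hne, hd, hd', heq⟩ := hc 0 h0
      have Q := isParam_extChartAt (n := n) (f (κ (c 0)))
      have hQ := mem_extChartAt_target (I := 𝓡 n) (f (κ (c 0)))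
      have hyy' := (extChartAt_to_inv (I := 𝓡 n) (f (κ (c 0)))).symm
      obtain ⟨h1, h2, h3⟩ := P'.transition Q hΩ hQ hyy'
      obtain ⟨e, he⟩ := P'.fderiv_transition_isInvertible Q hΩ hQ hyy'
      obtain ⟨h4, h5⟩ := acceleration_pullback hG' (c := c) hΩ (Q.isMetricOn g')
        (τ := fun z ↦ extChartAt (𝓡 n) (f (κ (c 0))) (f (κ z))) (by rwa [h1]) h2 ⟨e, he⟩
        (P'.formIn_transition Q hΩ hQ hyy' g')
        (by filter_upwards [hmem 0 h0] with s hs using (hc s hs).2.2.1) hd'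
      have h6 := hθ.symm.trans h5
      rw [h4, ← he, ← map_smul] at h6
      have h7 := e.injective h6
      rw [hc0, hc0'] at h7 heq
      refine ⟨θ, ?_⟩
      rw [h7, eq_neg_of_add_eq_zero_left heq]
      simp
      abel)
  refine ⟨ψ, fun u v ↦ ?_⟩
  have := hψ u v
  rw [sub_apply, sub_apply, sub_eq_iff_eq_add] at this
  rw [this]
  abel

end LocalGeometry

/-! ### Concircular fields in parametrizations. -/

namespace LocalGeometry

lemma cov_congr {E : Type*} [NormedAddCommGroup E] [NormedSpace ℝ E]
    {G : E → E →L[ℝ] E →L[ℝ] ℝ} {V W : E → E} {y : E} (h : V =ᶠ[𝓝 y] W) :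
    cov G V y = cov G W y := by
  rw [cov, cov, h.fderiv_eq, h.self_of_nhds]

variable {n : ℕ} {M : Type*} [TopologicalSpace M] [ChartedSpace (EuclideanSpace ℝ (Fin n)) M]

/-- The differential of a function, as a linear form on the model space. -/
def dFun (F : M → ℝ) (x : M) : EuclideanSpace ℝ (Fin n) →L[ℝ] ℝ :=
  mfderiv (𝓡 n) 𝓘(ℝ, ℝ) F x

namespace IsParam

variable {κ : EuclideanSpace ℝ (Fin n) → M} {k : M → EuclideanSpace ℝ (Fin n)}
  {Ω : Set (EuclideanSpace ℝ (Fin n))} {y : EuclideanSpace ℝ (Fin n)}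

lemma contMDiffAt_of_comp (P : IsParam κ k Ω) (hy : y ∈ Ω) {F : M → ℝ}
    (hF : ContDiffAt ℝ ∞ (fun z ↦ F (κ z)) y) : ContMDiffAt (𝓡 n) 𝓘(ℝ, ℝ) ∞ F (κ y) := by
  have h1 : ContMDiffAt 𝓘(ℝ, EuclideanSpace ℝ (Fin n)) 𝓘(ℝ, ℝ) ∞ (fun z ↦ F (κ z)) (k (κ y)) := by
    rw [P.left_inv y hy]
    exact hF.contMDiffAt
  refine (h1.comp (κ y) (P.contMDiffAt_inv hy)).congr_of_eventuallyEq ?_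
  filter_upwards [P.image_mem_nhds hy] with x hx
  rw [Function.comp_apply, (P.mem_and_right_inv hx).2]

lemma fderiv_comp (P : IsParam κ k Ω) (hy : y ∈ Ω) {F : M → ℝ}
    (hF : ContMDiffAt (𝓡 n) 𝓘(ℝ, ℝ) ∞ F (κ y)) :
    fderiv ℝ (fun z ↦ F (κ z)) y = (dFun F (κ y)).comp (dParam κ y) := by
  have h := ((hF.mdifferentiableAt (by simp)).hasMFDerivAt.comp y
    ((P.contMDiffAt hy).mdifferentiableAt (by simp)).hasMFDerivAt)
  have h' : HasFDerivAt (fun z ↦ F (κ z)) ((dFun F (κ y)).comp (dParam κ y)) y :=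
    hasMFDerivAt_iff_hasFDerivAt.1 h
  exact h'.fderiv

end IsParam

lemma exists_isParam [IsManifold (𝓡 n) ∞ M] (x : M) : ∃ (κ : EuclideanSpace ℝ (Fin n) → M)
    (k : M → EuclideanSpace ℝ (Fin n)) (Ω : Set (EuclideanSpace ℝ (Fin n)))
    (y : EuclideanSpace ℝ (Fin n)), IsParam κ k Ω ∧ y ∈ Ω ∧ κ y = x :=
  ⟨_, _, _, _, isParam_extChartAt x, mem_extChartAt_target x, extChartAt_to_inv x⟩

/-- A smooth vector field whose covariant differential is, in every parametrization, pointwise a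
multiple of the identity. -/
structure IsConcircularField [IsManifold (𝓡 n) ∞ M] (g : PseudoRiemannianMetric n M)
    (V : M → EuclideanSpace ℝ (Fin n)) : Prop where
  smooth : ContMDiff (𝓡 n) (𝓡 n).tangent ∞ (fun x ↦ (⟨x, V x⟩ : TangentBundle (𝓡 n) M))
  exists_eq {κ : EuclideanSpace ℝ (Fin n) → M} {k : M → EuclideanSpace ℝ (Fin n)}
    {Ω : Set (EuclideanSpace ℝ (Fin n))} (P : IsParam κ k Ω) {y : EuclideanSpace ℝ (Fin n)}
    (hy : y ∈ Ω) : ∃ r : ℝ, ∀ u, cov (g.formIn κ) (fieldIn V κ k) y u = r • u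

variable [IsManifold (𝓡 n) ∞ M] {g : PseudoRiemannianMetric n M} {V : M → EuclideanSpace ℝ (Fin n)}

lemma contMDiff_field_of_fieldIn
    (h : ∀ {κ : EuclideanSpace ℝ (Fin n) → M} {k : M → EuclideanSpace ℝ (Fin n)}
      {Ω : Set (EuclideanSpace ℝ (Fin n))}, IsParam κ k Ω → ∀ y ∈ Ω,
      ContDiffAt ℝ ∞ (fieldIn V κ k) y) :
    ContMDiff (𝓡 n) (𝓡 n).tangent ∞ (fun x ↦ (⟨x, V x⟩ : TangentBundle (𝓡 n) M)) := by
  intro x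
  obtain ⟨κ, k, Ω, y, P, hy, rfl⟩ := exists_isParam (n := n) x
  exact P.contMDiffAt_of_fieldIn hy (h P y hy)

lemma isConcircularField_of_isConcircular {ρ : M → ℝ} (h : g.IsConcircular V ρ) :
    IsConcircularField g V :=
  ⟨h.1, fun {κ _ _} P {y} hy ↦ ⟨ρ (κ y), (P.concircular_iff hy h.1 _).1 (h.2.2 (κ y))⟩⟩

lemma IsConcircularField.contDiffAt_cov (h : IsConcircularField g V)
    {κ : EuclideanSpace ℝ (Fin n) → M} {k : M → EuclideanSpace ℝ (Fin n)}
    {Ω : Set (EuclideanSpace ℝ (Fin n))} (P : IsParam κ k Ω) {y : EuclideanSpace ℝ (Fin n)}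
    (hy : y ∈ Ω) (u : EuclideanSpace ℝ (Fin n)) :
    ContDiffAt ℝ ∞ (fun z ↦ cov (g.formIn κ) (fieldIn V κ k) z u) y := by
  have h1 := P.contDiffAt_fieldIn hy h.smooth.contMDiffAt
  have h2 : ContDiffAt ℝ ∞ (fun z ↦ fderiv ℝ (fieldIn V κ k) z u) y :=
    (h1.fderiv_right (m := ∞) (by simp)).clm_apply contDiffAt_const
  have h3 : ContDiffAt ℝ ∞ (fun z ↦ leviCivita (g.formIn κ) z u (fieldIn V κ k z)) y :=
    (((P.isMetricOn g).contDiffAt_leviCivita hy).clm_apply contDiffAt_const).clm_apply h1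
  exact h2.add h3

/-- The function `ρ` of a concircular field is automatically smooth. -/
lemma IsConcircularField.exists_isConcircular (hn : n ≠ 0) (h : IsConcircularField g V) :
    ∃ ρ, g.IsConcircular V ρ := by
  have hex : ∀ x : M, ∃ r : ℝ, ∀ X Y : TangentSpace (𝓡 n) x,
      g.form x (g.covDeriv V x Y) X = r * g.form x X Y := by
    intro x
    obtain ⟨κ, k, Ω, y, P, hy, rfl⟩ := exists_isParam (n := n) x
    obtain ⟨r, hr⟩ := h.exists_eq P hy
    exact ⟨r, (P.concircular_iff hy h.smooth r).2 hr⟩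
  choose ρ hρ using hex
  refine ⟨ρ, h.smooth, fun x ↦ ?_, hρ⟩
  obtain ⟨κ, k, Ω, y, P, hy, rfl⟩ := exists_isParam (n := n) x
  refine P.contMDiffAt_of_comp hy ?_
  let i : Fin n := ⟨0, Nat.pos_of_ne_zero hn⟩
  -- A diagonal component of `∇V = ρ id` recovers `ρ`; this needs at least one coordinate.
  have h1 : ContDiffAt ℝ ∞ (fun z ↦ cov (g.formIn κ) (fieldIn V κ k) z
      (EuclideanSpace.single i 1) i) y :=
    (EuclideanSpace.proj (𝕜 := ℝ) i).contDiff.contDiffAt.comp y (h.contDiffAt_cov P hy _)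
  refine h1.congr_of_eventuallyEq ?_
  filter_upwards [P.isOpen.mem_nhds hy] with z hz
  rw [(P.concircular_iff hz h.smooth _).1 (hρ (κ z))]
  simp

/-- In an equidistant space of the exceptional type all concircular fields are parallel. -/
lemma IsConcircularField.cov_eq_zero (hn : n ≠ 0) (hg : g.IsExceptionalEquidistant)
    (h : IsConcircularField g V) {κ : EuclideanSpace ℝ (Fin n) → M}
    {k : M → EuclideanSpace ℝ (Fin n)} {Ω : Set (EuclideanSpace ℝ (Fin n))} (P : IsParam κ k Ω)
    {y : EuclideanSpace ℝ (Fin n)} (hy : y ∈ Ω) : cov (g.formIn κ) (fieldIn V κ k) y = 0 := by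
  obtain ⟨ρ, hρ⟩ := h.exists_isConcircular hn
  by_cases hV : ∃ x, V x ≠ 0
  · ext1 u
    rw [(P.concircular_iff hy h.smooth _).1 (hρ.2.2 (κ y)), hg.2 V ρ hV hρ (κ y)]
    simp
  -- The exceptional condition says nothing about the zero field, which is parallel anyway.
  · push Not at hV
    have h0 : fieldIn V κ k = fun _ ↦ 0 := by
      ext1 z
      change dCoord k (κ z) (V (κ z)) = 0
      rw [hV, map_zero]
    rw [h0]
    ext1 u
    simp [cov_apply]

end LocalGeometry

/-! ### The Sinyukov solution of a geodesic mapping as a global object. -/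

namespace LocalGeometry

variable {n : ℕ} {M : Type*} [TopologicalSpace M] [ChartedSpace (EuclideanSpace ℝ (Fin n)) M]
  {N : Type*} [TopologicalSpace N] [ChartedSpace (EuclideanSpace ℝ (Fin n)) N]

/-- The differential of a map between manifolds, as an endomorphism of the model space. -/
def dMap (f : M → N) (x : M) : EuclideanSpace ℝ (Fin n) →L[ℝ] EuclideanSpace ℝ (Fin n) :=
  mfderiv (𝓡 n) (𝓡 n) f x

variable {κ : EuclideanSpace ℝ (Fin n) → M} {k : M → EuclideanSpace ℝ (Fin n)}
  {Ω : Set (EuclideanSpace ℝ (Fin n))} {y : EuclideanSpace ℝ (Fin n)}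

lemma IsParam.dParam_comp (P : IsParam κ k Ω) (hy : y ∈ Ω) (f : M ≃ₘ^∞⟮𝓡 n, 𝓡 n⟯ N) :
    dParam (fun y ↦ f (κ y)) y = (dMap f (κ y)).comp (dParam κ y) :=
  ((f.contMDiff.contMDiffAt.mdifferentiableAt (by simp)).hasMFDerivAt.comp y
    ((P.contMDiffAt hy).mdifferentiableAt (by simp)).hasMFDerivAt).mfderiv

lemma IsParam.dCoord_comp (P : IsParam κ k Ω) (hy : y ∈ Ω) (f : M ≃ₘ^∞⟮𝓡 n, 𝓡 n⟯ N) :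
    dCoord (fun x ↦ k (f.symm x)) (f (κ y)) =
      (dCoord k (κ y)).comp (dMap f.symm (f (κ y))) := by
  have h1 := ((P.contMDiffAt_inv hy).mdifferentiableAt (by simp)).hasMFDerivAt
  have h2 := (f.symm.contMDiff.contMDiffAt (x := f (κ y))).mdifferentiableAt
    (by simp : (∞ : WithTop ℕ∞) ≠ 0)
  have h3 : κ y = f.symm (f (κ y)) := (f.symm_apply_apply _).symm
  rw [h3] at h1
  have h4 : mfderiv (𝓡 n) 𝓘(ℝ, EuclideanSpace ℝ (Fin n)) (fun x ↦ k (f.symm x)) (f (κ y)) = _ :=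
    (h1.comp (f (κ y)) h2.hasMFDerivAt).mfderiv
  have h5 : dCoord (fun x ↦ k (f.symm x)) (f (κ y)) =
      (dCoord k (f.symm (f (κ y)))).comp (dMap f.symm (f (κ y))) := h4
  rw [← h3] at h5
  exact h5

lemma dMap_symm_comp (f : M ≃ₘ^∞⟮𝓡 n, 𝓡 n⟯ N) (x : M) :
    (dMap (n := n) f.symm (f x)).comp (dMap (n := n) f x) = ContinuousLinearMap.id ℝ _ := by
  have h1 := ((f.symm.contMDiff.contMDiffAt (x := f x)).mdifferentiableAt
    (by simp : (∞ : WithTop ℕ∞) ≠ 0)).hasMFDerivAt.comp x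
    (f.contMDiff.contMDiffAt.mdifferentiableAt (by simp)).hasMFDerivAt
  have h2 : f.symm ∘ f = id := funext fun x ↦ f.symm_apply_apply x
  rw [h2] at h1
  exact hasMFDerivAt_unique h1 (hasMFDerivAt_id x)

section FieldIn

variable {V W : M → EuclideanSpace ℝ (Fin n)}

lemma dParam_fieldIn (P : IsParam κ k Ω) (hy : y ∈ Ω) :
    dParam κ y (fieldIn V κ k y) = V (κ y) :=
  ((P.fieldIn_eq_iff hy V _).1 rfl).symm

lemma fieldIn_eq_zero_iff (P : IsParam κ k Ω) (hy : y ∈ Ω) :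
    fieldIn V κ k y = 0 ↔ V (κ y) = 0 :=
  (P.fieldIn_eq_iff hy V 0).trans (by rw [map_zero]; rfl)

lemma fieldIn_smul (c : M → ℝ) (y : EuclideanSpace ℝ (Fin n)) :
    fieldIn (fun x ↦ c x • V x) κ k y = c (κ y) • fieldIn V κ k y :=
  map_smul (dCoord k (κ y)) _ _

lemma fieldIn_sub (y : EuclideanSpace ℝ (Fin n)) :
    fieldIn (fun x ↦ V x - W x) κ k y = fieldIn V κ k y - fieldIn W κ k y :=
  map_sub (dCoord k (κ y)) _ _

end FieldIn

variable [IsManifold (𝓡 n) ∞ N]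

/-- The pullback of a metric under a map. -/
def pullForm (g' : PseudoRiemannianMetric n N) (f : M → N) (x : M) :
    EuclideanSpace ℝ (Fin n) →L[ℝ] EuclideanSpace ℝ (Fin n) →L[ℝ] ℝ :=
  (g'.formAt (f x)).bilinearComp (dMap f x) (dMap f x)

lemma formIn_comp (P : IsParam κ k Ω) (hy : y ∈ Ω) (g' : PseudoRiemannianMetric n N)
    (f : M ≃ₘ^∞⟮𝓡 n, 𝓡 n⟯ N) :
    g'.formIn (fun y ↦ f (κ y)) y =
      (pullForm g' f (κ y)).bilinearComp (dParam κ y) (dParam κ y) := by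
  rw [PseudoRiemannianMetric.formIn, P.dParam_comp hy f]
  rfl

variable [IsManifold (𝓡 n) ∞ M]

/-- The projective scale factor of `g` and the pullback of `g'`. -/
def scaleAt (g : PseudoRiemannianMetric n M) (g' : PseudoRiemannianMetric n N) (f : M → N)
    (x : M) : ℝ :=
  projScale (g.formAt x) (pullForm g' f x)

/-- The solution of the Sinyukov equation given by `g` and the pullback of `g'`. -/
def endoAt (g : PseudoRiemannianMetric n M) (g' : PseudoRiemannianMetric n N) (f : M → N) (x : M) :
    EuclideanSpace ℝ (Fin n) →L[ℝ] EuclideanSpace ℝ (Fin n) :=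
  projEndo (g.formAt x) (pullForm g' f x)

/-- Half the trace of `endoAt`. -/
def halfTraceAt (g : PseudoRiemannianMetric n M) (g' : PseudoRiemannianMetric n N) (f : M → N)
    (x : M) : ℝ :=
  (1 / 2 : ℝ) * traceL _ (endoAt g g' f x)

/-- The gradient of half the trace of `endoAt`. -/
def gradAt (g : PseudoRiemannianMetric n M) (g' : PseudoRiemannianMetric n N) (f : M → N) (x : M) :
    EuclideanSpace ℝ (Fin n) :=
  (g.formAt x).inverse (dFun (halfTraceAt g g' f) x)

variable {g : PseudoRiemannianMetric n M} {g' : PseudoRiemannianMetric n N}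
  {f : M ≃ₘ^∞⟮𝓡 n, 𝓡 n⟯ N} {V W : M → EuclideanSpace ℝ (Fin n)}

lemma isMetricForm_pullForm (x : M) : IsMetricForm (pullForm g' f x) := by
  obtain ⟨κ, k, Ω, y, P, hy, rfl⟩ := exists_isParam (n := n) x
  obtain ⟨e, he, he'⟩ := P.exists_equiv hy
  have h := ((P.comp_diffeomorph f).isMetricOn g').isMetricForm y hy
  have h2 : pullForm g' f (κ y) = (g'.formIn (fun y ↦ f (κ y)) y).bilinearComp
      (e.symm : EuclideanSpace ℝ (Fin n) →L[ℝ] EuclideanSpace ℝ (Fin n))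
      (e.symm : EuclideanSpace ℝ (Fin n) →L[ℝ] EuclideanSpace ℝ (Fin n)) := by
    rw [formIn_comp P hy g' f, ← he]
    ext u v
    simp
  rw [h2]
  exact h.bilinearComp ⟨e.symm, rfl⟩

lemma formIn_apply_fieldIn (P : IsParam κ k Ω) (hy : y ∈ Ω) :
    g.formIn κ y (fieldIn V κ k y) (fieldIn W κ k y) = g.formAt (κ y) (V (κ y)) (W (κ y)) := by
  change g.formAt (κ y) (dParam κ y _) (dParam κ y _) = _
  rw [dParam_fieldIn P hy, dParam_fieldIn P hy]

lemma projScale_formIn (P : IsParam κ k Ω) (hy : y ∈ Ω) :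
    projScale (g.formIn κ y) (g'.formIn (fun y ↦ f (κ y)) y) = scaleAt g g' f (κ y) := by
  obtain ⟨e, he, -⟩ := P.exists_equiv hy
  rw [formIn_comp P hy g' f, PseudoRiemannianMetric.formIn, ← he,
    projScale_bilinearComp (isMetricForm_pullForm (κ y)), scaleAt]

lemma projEndo_formIn (P : IsParam κ k Ω) (hy : y ∈ Ω) :
    projEndo (g.formIn κ y) (g'.formIn (fun y ↦ f (κ y)) y) =
      (dCoord k (κ y)).comp ((endoAt g g' f (κ y)).comp (dParam κ y)) := by
  obtain ⟨e, he, he'⟩ := P.exists_equiv hy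
  rw [formIn_comp P hy g' f, PseudoRiemannianMetric.formIn, ← he, ← he',
    projEndo_bilinearComp (isMetricForm_pullForm (κ y)), endoAt]

lemma fieldIn_endoAt (P : IsParam κ k Ω) (hy : y ∈ Ω) :
    fieldIn (fun x ↦ endoAt g g' f x (V x)) κ k y =
      projEndo (g.formIn κ y) (g'.formIn (fun y ↦ f (κ y)) y) (fieldIn V κ k y) := by
  rw [projEndo_formIn P hy, ContinuousLinearMap.comp_apply, ContinuousLinearMap.comp_apply,
    dParam_fieldIn P hy]
  rfl

lemma fieldIn_endoAt_pow (P : IsParam κ k Ω) (hy : y ∈ Ω) (j : ℕ) :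
    fieldIn (fun x ↦ (endoAt g g' f x ^ j) (V x)) κ k y =
      (projEndo (g.formIn κ y) (g'.formIn (fun y ↦ f (κ y)) y) ^ j) (fieldIn V κ k y) := by
  induction j with
  | zero => rfl
  | succ j ih =>
    simp only [pow_succ_apply]
    rw [fieldIn_endoAt P hy, ih]

lemma halfTraceAt_param (P : IsParam κ k Ω) (hy : y ∈ Ω) :
    (1 / 2 : ℝ) * traceL _ (projEndo (g.formIn κ y) (g'.formIn (fun y ↦ f (κ y)) y)) =
      halfTraceAt g g' f (κ y) := by
  obtain ⟨e, he, he'⟩ := P.exists_equiv hy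
  have := traceL_conj (endoAt g g' f (κ y)) e.symm
  rw [projEndo_formIn P hy, halfTraceAt, ← he, ← he', ← this]
  rfl

lemma contMDiff_halfTraceAt : ContMDiff (𝓡 n) 𝓘(ℝ, ℝ) ∞ (halfTraceAt g g' f) := by
  intro x
  obtain ⟨κ, k, Ω, y, P, hy, rfl⟩ := exists_isParam (n := n) x
  refine P.contMDiffAt_of_comp hy ((contDiffAt_trace_projEndo (P.isMetricOn g)
    ((P.comp_diffeomorph f).isMetricOn g') hy).congr_of_eventuallyEq ?_)
  filter_upwards [P.isOpen.mem_nhds hy] with z hz using (halfTraceAt_param P hz).symm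

lemma fieldIn_gradAt (P : IsParam κ k Ω) (hy : y ∈ Ω) :
    fieldIn (gradAt g g' f) κ k y = projGrad (g.formIn κ) (g'.formIn fun y ↦ f (κ y)) y := by
  have hGy := (P.isMetricOn g).isMetricForm y hy
  refine hGy.ext fun w ↦ ?_
  rw [projGrad, hGy.apply_inverse]
  have hev : (fun z ↦ (1 / 2 : ℝ) * traceL _ (projEndo (g.formIn κ z)
      (g'.formIn (fun y ↦ f (κ y)) z))) =ᶠ[𝓝 y] fun z ↦ halfTraceAt g g' f (κ z) := by
    filter_upwards [P.isOpen.mem_nhds hy] with z hz using halfTraceAt_param P hz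
  rw [hev.fderiv_eq, P.fderiv_comp hy contMDiff_halfTraceAt.contMDiffAt]
  change g.formAt (κ y) (dParam κ y _) (dParam κ y w) = _
  rw [dParam_fieldIn P hy, gradAt, (g.isMetricForm (κ y)).apply_inverse]
  rfl

/-- The Sinyukov equation for a geodesic mapping. -/
lemma exists_sinyukov_of_isGeodesicMapping (hf : g.IsGeodesicMapping g' f) (P : IsParam κ k Ω)
    (hy : y ∈ Ω) :
    ∃ ψ : EuclideanSpace ℝ (Fin n) →L[ℝ] ℝ,
      (∀ u v, leviCivita (g'.formIn fun y ↦ f (κ y)) y u v =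
        leviCivita (g.formIn κ) y u v + ψ u • v + ψ v • u) ∧
      (∀ v x, covEndo (g.formIn κ)
          (fun z ↦ projEndo (g.formIn κ z) (g'.formIn (fun y ↦ f (κ y)) z)) y v x =
        g.formIn κ y (fieldIn (gradAt g g' f) κ k y) x • v
          + g.formIn κ y x v • fieldIn (gradAt g g' f) κ k y) ∧
      (∀ x, ψ (projEndo (g.formIn κ y) (g'.formIn (fun y ↦ f (κ y)) y) x) =
        -g.formIn κ y (fieldIn (gradAt g g' f) κ k y) x) ∧
      ∀ v, fderiv ℝ (fun z ↦ scaleAt g g' f (κ z)) y v = 2 * ψ v * scaleAt g g' f (κ y) := by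
  have hG := P.isMetricOn g
  have hH := (P.comp_diffeomorph f).isMetricOn g'
  obtain ⟨ψ, hψ⟩ := exists_leviCivita_eq_of_isGeodesicMapping hf P hy
  obtain ⟨h1, h2⟩ := exists_sinyukov hG hH hy hψ
  have h3 := fderiv_projScale hG hH hy hψ
  have hev : (fun z ↦ projScale (g.formIn κ z) (g'.formIn (fun y ↦ f (κ y)) z)) =ᶠ[𝓝 y]
      fun z ↦ scaleAt g g' f (κ z) := by
    filter_upwards [P.isOpen.mem_nhds hy] with z hz using projScale_formIn P hz
  rw [hev.fderiv_eq, projScale_formIn P hy] at h3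
  rw [fieldIn_gradAt P hy]
  exact ⟨ψ, hψ, h1, h2, h3⟩

lemma contDiffAt_fieldIn_gradAt (P : IsParam κ k Ω) (hy : y ∈ Ω) :
    ContDiffAt ℝ ∞ (fieldIn (gradAt g g' f) κ k) y := by
  refine (contDiffAt_projGrad (P.isMetricOn g) ((P.comp_diffeomorph f).isMetricOn g')
    hy).congr_of_eventuallyEq ?_
  filter_upwards [P.isOpen.mem_nhds hy] with z hz using fieldIn_gradAt P hz

open Classical in
/-- The vector field `λ`, restricted to the set where `V` does not vanish. -/
def gradOn (g : PseudoRiemannianMetric n M) (g' : PseudoRiemannianMetric n N) (f : M → N)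
    (V : M → EuclideanSpace ℝ (Fin n)) (x : M) : EuclideanSpace ℝ (Fin n) :=
  if V x = 0 then 0 else gradAt g g' f x

lemma fieldIn_gradOn_of_ne (P : IsParam κ k Ω) (hy : y ∈ Ω)
    (hV : ContMDiff (𝓡 n) (𝓡 n).tangent ∞ (fun x ↦ (⟨x, V x⟩ : TangentBundle (𝓡 n) M)))
    (h0 : fieldIn V κ k y ≠ 0) :
    fieldIn (gradOn g g' f V) κ k =ᶠ[𝓝 y] fieldIn (gradAt g g' f) κ k := by
  filter_upwards [(P.contDiffAt_fieldIn hy hV.contMDiffAt).continuousAt.eventually_ne h0,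
    P.isOpen.mem_nhds hy] with z hz hzΩ
  rw [Ne, fieldIn_eq_zero_iff P hzΩ] at hz
  change dCoord k (κ z) (gradOn g g' f V (κ z)) = dCoord k (κ z) (gradAt g g' f (κ z))
  rw [gradOn, if_neg hz]

/-- Where `V ≠ 0`, the parallel field `V` forces `∇λ` to be a multiple of the identity. The manifold
need not be connected, so `V` may vanish on part of it; the zeros of a parallel field form an open
set, so cutting `λ` off there keeps it smooth. -/
lemma isConcircularField_gradOn (hn : n ≠ 0) (hg : g.IsExceptionalEquidistant)
    (hf : g.IsGeodesicMapping g' f) (hV : IsConcircularField g V) :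
    IsConcircularField g (gradOn g g' f V) := by
  have hzero : ∀ {κ : EuclideanSpace ℝ (Fin n) → M} {k : M → EuclideanSpace ℝ (Fin n)}
      {Ω : Set (EuclideanSpace ℝ (Fin n))} {y : EuclideanSpace ℝ (Fin n)}, IsParam κ k Ω → y ∈ Ω →
      fieldIn V κ k y = 0 → fieldIn (gradOn g g' f V) κ k =ᶠ[𝓝 y] fun _ ↦ 0 := by
    intro κ k Ω y P hy h0
    filter_upwards [(P.isMetricOn g).eventually_eq_zero_of_cov_eq_zero hy
      (fun z hz ↦ (P.contDiffAt_fieldIn hz hV.smooth.contMDiffAt).differentiableAt (by simp))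
      (fun z hz ↦ hV.cov_eq_zero hn hg P hz) h0, P.isOpen.mem_nhds hy] with z hz hzΩ
    rw [fieldIn_eq_zero_iff P hzΩ] at hz ⊢
    rw [gradOn, if_pos hz]
  refine ⟨contMDiff_field_of_fieldIn fun {κ k Ω} P y hy ↦ ?_, fun {κ k Ω} P {y} hy ↦ ?_⟩
  · by_cases h0 : fieldIn V κ k y = 0
    · exact contDiffAt_const.congr_of_eventuallyEq (hzero P hy h0)
    · exact (contDiffAt_fieldIn_gradAt P hy).congr_of_eventuallyEq
        (fieldIn_gradOn_of_ne P hy hV.smooth h0)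
  · by_cases h0 : fieldIn V κ k y = 0
    · refine ⟨0, fun u ↦ ?_⟩
      rw [cov_congr (hzero P hy h0)]
      simp [cov_apply]
    · rw [cov_congr (fieldIn_gradOn_of_ne P hy hV.smooth h0)]
      have hG := P.isMetricOn g
      have hH := (P.comp_diffeomorph f).isMetricOn g'
      refine hG.exists_cov_eq_smul (φ := fieldIn V κ k) hy (contDiffAt_projEndo hG hH hy)
        ((contDiffAt_fieldIn_gradAt P hy).differentiableAt (by simp))
        (fun z hz ↦ ?_) (contDiffAt_trace_projEndo hG hH hy) (fun z hz ↦ ?_)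
        (P.contDiffAt_fieldIn hy hV.smooth.contMDiffAt)
        (fun z hz ↦ hV.cov_eq_zero hn hg P hz) h0
      · obtain ⟨ψ, -, h, -⟩ := exists_sinyukov_of_isGeodesicMapping hf P hz
        exact h
      · rw [fieldIn_gradAt P hz, projGrad, (hG.isMetricForm z hz).apply_inverse]

end LocalGeometry

/-! ### Orthogonality of all `a^m V` to `λ`. -/

namespace LocalGeometry

variable {n : ℕ} {M : Type*} [TopologicalSpace M] [ChartedSpace (EuclideanSpace ℝ (Fin n)) M]
  {N : Type*} [TopologicalSpace N] [ChartedSpace (EuclideanSpace ℝ (Fin n)) N]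
  [IsManifold (𝓡 n) ∞ N] [IsManifold (𝓡 n) ∞ M]

/-- The field `2 g(a ^ m V, λ) a V - g(a ^ (m + 1) V, V) λ`. -/
def combField (g : PseudoRiemannianMetric n M) (g' : PseudoRiemannianMetric n N) (f : M → N)
    (m : ℕ) (V : M → EuclideanSpace ℝ (Fin n)) (x : M) : EuclideanSpace ℝ (Fin n) :=
  (2 * g.formAt x ((endoAt g g' f x ^ m) (V x)) (gradAt g g' f x)) • endoAt g g' f x (V x)
    - g.formAt x ((endoAt g g' f x ^ (m + 1)) (V x)) (V x) • gradAt g g' f x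

variable {g : PseudoRiemannianMetric n M} {g' : PseudoRiemannianMetric n N}
  {f : M ≃ₘ^∞⟮𝓡 n, 𝓡 n⟯ N} {V : M → EuclideanSpace ℝ (Fin n)}
  {κ : EuclideanSpace ℝ (Fin n) → M} {k : M → EuclideanSpace ℝ (Fin n)}
  {Ω : Set (EuclideanSpace ℝ (Fin n))} {y : EuclideanSpace ℝ (Fin n)}

lemma fieldIn_combField (P : IsParam κ k Ω) (m : ℕ) (hy : y ∈ Ω) :
    let G := g.formIn κ
    let a := fun z ↦ projEndo (G z) (g'.formIn (fun y ↦ f (κ y)) z)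
    let φ := fieldIn V κ k
    let l := fieldIn (gradAt g g' f) κ k
    fieldIn (combField g g' f m V) κ k =ᶠ[𝓝 y] fun z ↦
      (2 * G z ((a z ^ m) (φ z)) (l z)) • a z (φ z) - G z ((a z ^ (m + 1)) (φ z)) (φ z) • l z := by
  intro G a φ l
  filter_upwards [P.isOpen.mem_nhds hy] with z hz
  have h1 := formIn_apply_fieldIn (g := g) (V := fun x ↦ (endoAt g g' f x ^ m) (V x))
    (W := gradAt g g' f) P hz
  have h2 := formIn_apply_fieldIn (g := g) (V := fun x ↦ (endoAt g g' f x ^ (m + 1)) (V x))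
    (W := V) P hz
  rw [fieldIn_endoAt_pow P hz] at h1 h2
  have h3 := fieldIn_sub (κ := κ) (k := k)
    (V := fun x ↦ (2 * g.formAt x ((endoAt g g' f x ^ m) (V x)) (gradAt g g' f x)) •
      endoAt g g' f x (V x))
    (W := fun x ↦ g.formAt x ((endoAt g g' f x ^ (m + 1)) (V x)) (V x) • gradAt g g' f x) z
  rw [fieldIn_smul (V := fun x ↦ endoAt g g' f x (V x)), fieldIn_smul, fieldIn_endoAt P hz,
    ← h1, ← h2] at h3
  exact h3

/-- The orthogonality relations required by `IsMetricOn.cov_combination` are the hypothesis `hm`,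
applied to `V` and to the cut-off `λ`. The latter is itself concircular, hence parallel. -/
lemma cov_combField (hf : g.IsGeodesicMapping g' f) (hn : n ≠ 0)
    (hg : g.IsExceptionalEquidistant) (hV : IsConcircularField g V)
    {m : ℕ} (hm : ∀ i < m, ∀ W, IsConcircularField g W → ∀ x,
      g.formAt x ((endoAt g g' f x ^ i) (W x)) (gradAt g g' f x) = 0)
    (P : IsParam κ k Ω) (hy : y ∈ Ω) (u : EuclideanSpace ℝ (Fin n)) :
    cov (g.formIn κ) (fieldIn (combField g g' f m V) κ k) y u =
      (2 * g.formAt (κ y) ((endoAt g g' f (κ y) ^ m) (V (κ y))) (gradAt g g' f (κ y)) *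
        g.formAt (κ y) (V (κ y)) (gradAt g g' f (κ y))) • u := by
  have hG := P.isMetricOn g
  have hH := (P.comp_diffeomorph f).isMetricOn g'
  have hpow : ∀ i (W : M → EuclideanSpace ℝ (Fin n)), g.formIn κ y
      ((projEndo (g.formIn κ y) (g'.formIn (fun y ↦ f (κ y)) y) ^ i) (fieldIn W κ k y))
      (fieldIn (gradAt g g' f) κ k y) =
      g.formAt (κ y) ((endoAt g g' f (κ y) ^ i) (W (κ y))) (gradAt g g' f (κ y)) := by
    intro i W
    rw [← fieldIn_endoAt_pow P hy]
    exact formIn_apply_fieldIn (V := fun x ↦ (endoAt g g' f x ^ i) (W x)) P hy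
  obtain ⟨ψ, -, hcov, -⟩ := exists_sinyukov_of_isGeodesicMapping hf P hy
  rw [cov_congr (fieldIn_combField P m hy),
    hG.cov_combination hy ((contDiffAt_projEndo hG hH hy).differentiableAt (by simp))
      ((contDiffAt_fieldIn_gradAt P hy).differentiableAt (by simp))
      ((P.contDiffAt_fieldIn hy hV.smooth.contMDiffAt).differentiableAt (by simp))
      (projEndo_selfAdjoint (hG.isMetricForm y hy) (hH.isMetricForm y hy)) hcov
      (hV.cov_eq_zero hn hg P hy), hpow]
  · rw [← formIn_apply_fieldIn (W := gradAt g g' f) P hy]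
  · intro h0
    have hev := fieldIn_gradOn_of_ne (g := g) (g' := g') (f := f) P hy hV.smooth h0
    have hL := isConcircularField_gradOn hn hg hf hV
    refine ⟨?_, fun i hi ↦ ?_⟩
    · rw [← cov_congr hev]
      exact hL.cov_eq_zero hn hg P hy
    · have h1 := hm i hi _ hL (κ y)
      rw [← hpow, hev.self_of_nhds] at h1
      exact h1
  · intro i hi
    rw [hpow]
    exact hm i hi V hV (κ y)

lemma isConcircularField_combField (hn : n ≠ 0) (hg : g.IsExceptionalEquidistant)
    (hf : g.IsGeodesicMapping g' f) (hV : IsConcircularField g V)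
    {m : ℕ} (hm : ∀ i < m, ∀ W, IsConcircularField g W → ∀ x,
      g.formAt x ((endoAt g g' f x ^ i) (W x)) (gradAt g g' f x) = 0) :
    IsConcircularField g (combField g g' f m V) := by
  refine ⟨contMDiff_field_of_fieldIn fun {κ k Ω} P y hy ↦ ?_,
    fun {κ k Ω} P {y} hy ↦ ⟨_, cov_combField hf hn hg hV hm P hy⟩⟩
  refine ContDiffAt.congr_of_eventuallyEq ?_ (fieldIn_combField P m hy)
  have hG := (P.isMetricOn g).contDiffAt hy
  have ha := contDiffAt_projEndo (P.isMetricOn g) ((P.comp_diffeomorph f).isMetricOn g') hy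
  have hφ := P.contDiffAt_fieldIn hy hV.smooth.contMDiffAt
  have hl := contDiffAt_fieldIn_gradAt (g := g) (g' := g') (f := f) P hy
  exact ((contDiffAt_const.mul ((hG.clm_apply ((ha.pow m).clm_apply hφ)).clm_apply hl)).smul
    (ha.clm_apply hφ)).sub
    (((hG.clm_apply ((ha.pow (m + 1)).clm_apply hφ)).clm_apply hφ).smul hl)

/-- All `a ^ m V` are orthogonal to `λ`, for every concircular field `V`. -/
lemma formAt_endoAt_pow_gradAt_eq_zero (hn : n ≠ 0) (hg : g.IsExceptionalEquidistant)
    (hf : g.IsGeodesicMapping g' f) (m : ℕ) : ∀ V, IsConcircularField g V → ∀ x,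
      g.formAt x ((endoAt g g' f x ^ m) (V x)) (gradAt g g' f x) = 0 := by
  induction m using Nat.strong_induction_on with
  | _ m hm =>
    intro V hV x
    have hχ := isConcircularField_combField hn hg hf hV hm
    obtain _ | m := m
    · obtain ⟨κ, k, Ω, y, P, hy, rfl⟩ := exists_isParam (n := n) x
      -- For `m = 0` the factor of the combination is `2 g(V, λ)²`; it vanishes because the
      -- combination is parallel.
      have h1 := cov_combField hf hn hg hV hm P hy
        (EuclideanSpace.single ⟨0, Nat.pos_of_ne_zero hn⟩ 1)
      rw [hχ.cov_eq_zero hn hg P hy, zero_apply, eq_comm, smul_eq_zero] at h1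
      have h2 := h1.resolve_right (by simp)
      rw [pow_zero] at h2 ⊢
      change 2 * g.formAt (κ y) (V (κ y)) _ * _ = 0 at h2
      change g.formAt (κ y) (V (κ y)) _ = 0
      nlinarith
    · by_cases h0 : V x = 0
      · simp [h0]
      · have h1 := hm m (by lia) _ hχ x
        have h2 := hm m (by lia) _ (isConcircularField_gradOn hn hg hf hV) x
        rw [gradOn, if_neg h0] at h2
        have h3 : (endoAt g g' f x ^ m) (endoAt g g' f x (V x)) =
            (endoAt g g' f x ^ (m + 1)) (V x) := by
          rw [pow_succ]
          rfl
        rw [combField, map_sub, map_smul, map_smul, h3] at h1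
        simp only [map_sub, map_smul, sub_apply, smul_apply, smul_eq_mul, h2, mul_zero,
          sub_zero] at h1
        nlinarith

/-- The one-form `ψ` of a geodesic mapping of an exceptional equidistant space vanishes on
concircular fields. -/
lemma psi_apply_eq_zero (hn : n ≠ 0) (hg : g.IsExceptionalEquidistant)
    (hf : g.IsGeodesicMapping g' f) (hV : IsConcircularField g V) (P : IsParam κ k Ω) (hy : y ∈ Ω)
    {ψ : EuclideanSpace ℝ (Fin n) →L[ℝ] ℝ}
    (hψ : ∀ x, ψ (projEndo (g.formIn κ y) (g'.formIn (fun y ↦ f (κ y)) y) x) =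
      -g.formIn κ y (fieldIn (gradAt g g' f) κ k y) x) :
    ψ (fieldIn V κ k y) = 0 := by
  have hGy := (P.isMetricOn g).isMetricForm y hy
  have hHy := ((P.comp_diffeomorph f).isMetricOn g').isMetricForm y hy
  obtain ⟨e, he⟩ := isInvertible_projEndo hGy hHy
  set a := projEndo (g.formIn κ y) (g'.formIn (fun y ↦ f (κ y)) y)
  have hax : a (e.symm (fieldIn V κ k y)) = fieldIn V κ k y := by
    rw [← he]
    simp
  -- Since `ψ ∘ a = -g(λ, ·)`, the claim is that `a⁻¹V` is orthogonal to `λ`; this follows from the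
  -- orthogonality of the nonnegative powers.
  have h := apply_eq_zero_of_pow (a := a) (by rw [← he]; exact e.injective)
    (g.formIn κ y (fieldIn (gradAt g g' f) κ k y)) (x := e.symm (fieldIn V κ k y)) (fun m ↦ by
      rw [hax, ← fieldIn_endoAt_pow P hy, hGy.symm]
      exact (formIn_apply_fieldIn (V := fun x ↦ (endoAt g g' f x ^ m) (V x)) P hy).trans
        (formAt_endoAt_pow_gradAt_eq_zero hn hg hf m V hV (κ y)))
  rw [← hax, hψ, h, neg_zero]

end LocalGeometry

/-! ### Transport of concircular fields by a geodesic mapping, and the conclusion. -/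

namespace LocalGeometry

/-- The weight `F` compensates the change of the connection under a projective change. -/
lemma cov_smul_of_leviCivita_eq {E : Type*} [NormedAddCommGroup E] [NormedSpace ℝ E]
    {G H : E → E →L[ℝ] E →L[ℝ] ℝ} {ψ : E →L[ℝ] ℝ} {F : E → ℝ} {φ : E → E} {y : E}
    (h : ∀ u v, leviCivita H y u v = leviCivita G y u v + ψ u • v + ψ v • u)
    (hF : DifferentiableAt ℝ F y) (hFψ : ∀ v, fderiv ℝ F y v = -(ψ v * F y))
    (hφ : DifferentiableAt ℝ φ y) (v : E) :
    cov H (fun z ↦ F z • φ z) y v = F y • (cov G φ y v + ψ (φ y) • v) := by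
  rw [cov_smul hF hφ, hFψ, cov_apply, cov_apply, h]
  module

variable {n : ℕ} {M : Type*} [TopologicalSpace M] [ChartedSpace (EuclideanSpace ℝ (Fin n)) M]
  {N : Type*} [TopologicalSpace N] [ChartedSpace (EuclideanSpace ℝ (Fin n)) N]

lemma dMap_comp_symm (f : M ≃ₘ^∞⟮𝓡 n, 𝓡 n⟯ N) (x : M) :
    (dMap (n := n) f x).comp (dMap (n := n) f.symm (f x)) = ContinuousLinearMap.id ℝ _ := by
  have h := dMap_symm_comp f.symm (f x)
  rw [f.symm_apply_apply] at h
  exact h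

variable [IsManifold (𝓡 n) ∞ N] [IsManifold (𝓡 n) ∞ M]

/-- The push-forward of a vector field, rescaled such that parallel fields stay concircular under a
geodesic mapping. -/
def pushField (g : PseudoRiemannianMetric n M) (g' : PseudoRiemannianMetric n N)
    (f : M ≃ₘ^∞⟮𝓡 n, 𝓡 n⟯ N) (V : M → EuclideanSpace ℝ (Fin n)) (x : N) :
    EuclideanSpace ℝ (Fin n) :=
  (√(scaleAt g g' f (f.symm x)))⁻¹ • dMap f (f.symm x) (V (f.symm x))

/-- The inverse of `pushField`. -/
def pullField (g : PseudoRiemannianMetric n M) (g' : PseudoRiemannianMetric n N)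
    (f : M ≃ₘ^∞⟮𝓡 n, 𝓡 n⟯ N) (W : N → EuclideanSpace ℝ (Fin n)) (x : M) :
    EuclideanSpace ℝ (Fin n) :=
  √(scaleAt g g' f x) • dMap f.symm (f x) (W (f x))

variable {g : PseudoRiemannianMetric n M} {g' : PseudoRiemannianMetric n N}
  {f : M ≃ₘ^∞⟮𝓡 n, 𝓡 n⟯ N} {V : M → EuclideanSpace ℝ (Fin n)} {W : N → EuclideanSpace ℝ (Fin n)}
  {κ : EuclideanSpace ℝ (Fin n) → M} {k : M → EuclideanSpace ℝ (Fin n)}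
  {Ω : Set (EuclideanSpace ℝ (Fin n))} {y : EuclideanSpace ℝ (Fin n)}

lemma scaleAt_pos (x : M) : 0 < scaleAt g g' f x :=
  projScale_pos _ _

lemma sqrt_scaleAt_pos (x : M) : 0 < √(scaleAt g g' f x) :=
  Real.sqrt_pos.2 (scaleAt_pos x)

lemma pushField_pullField : pushField g g' f (pullField g g' f W) = W := by
  ext1 x
  obtain ⟨x, rfl⟩ : ∃ z, f z = x := f.surjective x
  have h := DFunLike.congr_fun (dMap_comp_symm f x) (W (f x))
  rw [ContinuousLinearMap.comp_apply] at h
  rw [pushField, pullField, f.symm_apply_apply, map_smul, h,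
    inv_smul_smul₀ (sqrt_scaleAt_pos x).ne']
  rfl

lemma pushField_eq_zero_iff {x : M} : pushField g g' f V (f x) = 0 ↔ V x = 0 := by
  have h := DFunLike.congr_fun (dMap_symm_comp f x) (V x)
  rw [ContinuousLinearMap.comp_apply] at h
  rw [pushField, f.symm_apply_apply, smul_eq_zero_iff_right (inv_ne_zero (sqrt_scaleAt_pos x).ne')]
  refine ⟨fun h0 ↦ ?_, fun h0 ↦ by rw [h0, map_zero]⟩
  rw [h0, map_zero] at h
  exact h.symm

lemma fieldIn_pushField (P : IsParam κ k Ω) (hy : y ∈ Ω) :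
    fieldIn (pushField g g' f V) (fun y ↦ f (κ y)) (fun x ↦ k (f.symm x)) y =
      (√(scaleAt g g' f (κ y)))⁻¹ • fieldIn V κ k y := by
  have h := DFunLike.congr_fun (dMap_symm_comp f (κ y)) (V (κ y))
  rw [ContinuousLinearMap.comp_apply] at h
  change dCoord (fun x ↦ k (f.symm x)) (f (κ y)) (pushField g g' f V (f (κ y))) = _
  rw [P.dCoord_comp hy f, ContinuousLinearMap.comp_apply, pushField, f.symm_apply_apply, map_smul,
    h, map_smul]
  rfl

lemma fieldIn_pullField (P : IsParam κ k Ω) (hy : y ∈ Ω) :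
    fieldIn (pullField g g' f W) κ k y =
      √(scaleAt g g' f (κ y)) •
        fieldIn W (fun y ↦ f (κ y)) (fun x ↦ k (f.symm x)) y := by
  change dCoord k (κ y) (pullField g g' f W (κ y)) =
    _ • dCoord (fun x ↦ k (f.symm x)) (f (κ y)) (W (f (κ y)))
  rw [P.dCoord_comp hy f, ContinuousLinearMap.comp_apply, pullField, map_smul]

lemma contDiffAt_scaleAt (P : IsParam κ k Ω) (hy : y ∈ Ω) :
    ContDiffAt ℝ ∞ (fun z ↦ scaleAt g g' f (κ z)) y := by
  refine (contDiffAt_projScale (P.isMetricOn g) ((P.comp_diffeomorph f).isMetricOn g')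
    hy).congr_of_eventuallyEq ?_
  filter_upwards [P.isOpen.mem_nhds hy] with z hz using (projScale_formIn P hz).symm

lemma contDiffAt_sqrt_scaleAt (P : IsParam κ k Ω) (hy : y ∈ Ω) :
    ContDiffAt ℝ ∞ (fun z ↦ √(scaleAt g g' f (κ z))) y :=
  (contDiffAt_scaleAt P hy).sqrt (scaleAt_pos _).ne'

lemma contMDiff_pushField
    (hV : ContMDiff (𝓡 n) (𝓡 n).tangent ∞ (fun x ↦ (⟨x, V x⟩ : TangentBundle (𝓡 n) M))) :
    ContMDiff (𝓡 n) (𝓡 n).tangent ∞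
      (fun x ↦ (⟨x, pushField g g' f V x⟩ : TangentBundle (𝓡 n) N)) := by
  intro x
  obtain ⟨x, rfl⟩ : ∃ z, f z = x := f.surjective x
  obtain ⟨κ, k, Ω, y, P, hy, rfl⟩ := exists_isParam (n := n) x
  refine (P.comp_diffeomorph f).contMDiffAt_of_fieldIn hy
    ((((contDiffAt_sqrt_scaleAt (g := g) (g' := g') (f := f) P hy).inv
      (sqrt_scaleAt_pos _).ne').smul
      (P.contDiffAt_fieldIn hy hV.contMDiffAt)).congr_of_eventuallyEq ?_)
  filter_upwards [P.isOpen.mem_nhds hy] with z hz using fieldIn_pushField P hz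

lemma contMDiff_pullField
    (hW : ContMDiff (𝓡 n) (𝓡 n).tangent ∞ (fun x ↦ (⟨x, W x⟩ : TangentBundle (𝓡 n) N))) :
    ContMDiff (𝓡 n) (𝓡 n).tangent ∞
      (fun x ↦ (⟨x, pullField g g' f W x⟩ : TangentBundle (𝓡 n) M)) := by
  refine contMDiff_field_of_fieldIn fun {κ k Ω} P y hy ↦ ?_
  refine ((contDiffAt_sqrt_scaleAt (g := g) (g' := g') (f := f) P hy).smul
      ((P.comp_diffeomorph f).contDiffAt_fieldIn hy hW.contMDiffAt)).congr_of_eventuallyEq ?_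
  filter_upwards [P.isOpen.mem_nhds hy] with z hz using fieldIn_pullField P hz

/-- From `ds = 2ψs` the weight `s ^ (-1/2)` has logarithmic derivative `-ψ`. This cancels the term
`ψ(v) V` of the changed connection and leaves `ψ(V) v`. -/
lemma cov_pushField (P : IsParam κ k Ω) (hy : y ∈ Ω)
    (hV : ContMDiff (𝓡 n) (𝓡 n).tangent ∞ (fun x ↦ (⟨x, V x⟩ : TangentBundle (𝓡 n) M)))
    {ψ : EuclideanSpace ℝ (Fin n) →L[ℝ] ℝ}
    (hψ : ∀ u v, leviCivita (g'.formIn fun y ↦ f (κ y)) y u v =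
      leviCivita (g.formIn κ) y u v + ψ u • v + ψ v • u)
    (hs : ∀ v, fderiv ℝ (fun z ↦ scaleAt g g' f (κ z)) y v = 2 * ψ v * scaleAt g g' f (κ y))
    (v : EuclideanSpace ℝ (Fin n)) :
    cov (g'.formIn fun y ↦ f (κ y))
        (fieldIn (pushField g g' f V) (fun y ↦ f (κ y)) fun x ↦ k (f.symm x)) y v =
      (√(scaleAt g g' f (κ y)))⁻¹ •
        (cov (g.formIn κ) (fieldIn V κ k) y v + ψ (fieldIn V κ k y) • v) := by
  have hev : fieldIn (pushField g g' f V) (fun y ↦ f (κ y)) (fun x ↦ k (f.symm x)) =ᶠ[𝓝 y]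
      fun z ↦ (√(scaleAt g g' f (κ z)))⁻¹ • fieldIn V κ k z := by
    filter_upwards [P.isOpen.mem_nhds hy] with z hz using fieldIn_pushField P hz
  have hsd := (contDiffAt_scaleAt (g := g) (g' := g') (f := f) P hy).differentiableAt (by simp)
  have hpos := sqrt_scaleAt_pos (g := g) (g' := g') (f := f) (κ y)
  have hF : HasFDerivAt (fun z ↦ (√(scaleAt g g' f (κ z)))⁻¹) _ y :=
    (hasDerivAt_inv hpos.ne').comp_hasFDerivAt y
      (hsd.hasFDerivAt.sqrt (scaleAt_pos (κ y)).ne')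
  rw [cov_congr hev]
  refine cov_smul_of_leviCivita_eq hψ hF.differentiableAt (fun v ↦ ?_)
    ((P.contDiffAt_fieldIn hy hV.contMDiffAt).differentiableAt (by simp)) v
  have hsq := Real.sq_sqrt (scaleAt_pos (g := g) (g' := g') (f := f) (κ y)).le
  rw [hF.fderiv]
  simp only [smul_apply, smul_eq_mul, hs]
  rw [← hsq, Real.sqrt_sq hpos.le]
  field_simp

/-- A geodesic mapping transports concircular fields. -/
lemma isConcircularField_pushField (hf : g.IsGeodesicMapping g' f) (hV : IsConcircularField g V) :
    IsConcircularField g' (pushField g g' f V) := by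
  have hsm := contMDiff_pushField (g := g) (g' := g') (f := f) hV.smooth
  refine ⟨hsm, fun {κ' k' Ω'} Q {y'} hy' ↦ ?_⟩
  obtain ⟨x, hx⟩ : ∃ x, f x = κ' y' := f.surjective _
  obtain ⟨κ, k, Ω, y, P, hy, rfl⟩ := exists_isParam (n := n) x
  obtain ⟨ψ, hψ, -, -, hs⟩ := exists_sinyukov_of_isGeodesicMapping hf P hy
  obtain ⟨r, hr⟩ := hV.exists_eq P hy
  refine ⟨(√(scaleAt g g' f (κ y)))⁻¹ * (r + ψ (fieldIn V κ k y)),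
    ((P.comp_diffeomorph f).cov_eq_smul_iff_of_transition Q hy hy' hx hsm _).1 fun u ↦ ?_⟩
  rw [cov_pushField P hy hV.smooth hψ hs, hr]
  module

/-- The formula for the covariant derivative of a pushed field is solved for that of the original
field, so `f.symm` need not be known to be a geodesic mapping. -/
lemma isConcircularField_pullField (hf : g.IsGeodesicMapping g' f) (hW : IsConcircularField g' W) :
    IsConcircularField g (pullField g g' f W) := by
  have hsm := contMDiff_pullField (g := g) (g' := g') (f := f) hW.smooth
  refine ⟨hsm, fun {κ k Ω} P {y} hy ↦ ?_⟩
  obtain ⟨ψ, hψ, -, -, hs⟩ := exists_sinyukov_of_isGeodesicMapping hf P hy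
  obtain ⟨r, hr⟩ := hW.exists_eq (P.comp_diffeomorph f) hy
  refine ⟨√(scaleAt g g' f (κ y)) * r - ψ (fieldIn (pullField g g' f W) κ k y), fun u ↦ ?_⟩
  have h := cov_pushField P hy hsm hψ hs u
  rw [pushField_pullField, hr, eq_inv_smul_iff₀ (sqrt_scaleAt_pos _).ne'] at h
  rw [eq_sub_of_add_eq h.symm]
  module

/-- All concircular fields of the image of an exceptional equidistant space are parallel. -/
lemma IsConcircularField.cov_eq_zero_of_isGeodesicMapping (hn : n ≠ 0)
    (hg : g.IsExceptionalEquidistant) (hf : g.IsGeodesicMapping g' f)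
    (hW : IsConcircularField g' W) (P : IsParam κ k Ω) (hy : y ∈ Ω)
    (u : EuclideanSpace ℝ (Fin n)) :
    cov (g'.formIn fun y ↦ f (κ y))
      (fieldIn W (fun y ↦ f (κ y)) fun x ↦ k (f.symm x)) y u = 0 := by
  obtain ⟨ψ, hψ, -, hψ', hs⟩ := exists_sinyukov_of_isGeodesicMapping hf P hy
  have hV := isConcircularField_pullField hf hW
  have h := cov_pushField P hy hV.smooth hψ hs u
  rw [pushField_pullField] at h
  -- Both contributions vanish: `∇V` by exceptionality of `g`, and `ψ(V)` by the orthogonality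
  -- argument.
  rw [h, hV.cov_eq_zero hn hg P hy, psi_apply_eq_zero hn hg hf hV P hy hψ']
  simp

/-- Geodesic mappings preserve the class of equidistant spaces of the exceptional type. -/
lemma isExceptionalEquidistant_of_isGeodesicMapping (hg : g.IsExceptionalEquidistant)
    (hf : g.IsGeodesicMapping g' f) : g'.IsExceptionalEquidistant := by
  obtain ⟨V, ρ, ⟨x, hx⟩, hV⟩ := hg.1
  -- In dimension `0` the tangent spaces are trivial and carry no nonzero field.
  have hn : n ≠ 0 := by
    rintro rfl
    exact hx (Subsingleton.elim (α := EuclideanSpace ℝ (Fin 0)) _ _)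
  constructor
  · obtain ⟨ρ', hρ'⟩ := (isConcircularField_pushField hf
      (isConcircularField_of_isConcircular hV)).exists_isConcircular hn
    exact ⟨_, ρ', ⟨f x, fun h ↦ hx (pushField_eq_zero_iff.1 h)⟩, hρ'⟩
  · intro W ρ' _ hW x'
    obtain ⟨x', rfl⟩ : ∃ z, f z = x' := f.surjective x'
    obtain ⟨κ, k, Ω, y, P, hy, rfl⟩ := exists_isParam (n := n) x'
    have hc := isConcircularField_of_isConcircular hW
    let u : EuclideanSpace ℝ (Fin n) := EuclideanSpace.single ⟨0, Nat.pos_of_ne_zero hn⟩ 1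
    have h1 := hc.cov_eq_zero_of_isGeodesicMapping hn hg hf P hy u
    rw [((P.comp_diffeomorph f).concircular_iff hy hW.1 _).1 (hW.2.2 (f (κ y))) u] at h1
    exact (smul_eq_zero.1 h1).resolve_right (by simp [u])

end LocalGeometry

end

theorem corollary3 {n : ℕ}
    {M : Type*} [TopologicalSpace M] [T2Space M] [SecondCountableTopology M]
    [ChartedSpace (EuclideanSpace ℝ (Fin n)) M] [IsManifold (𝓡 n) ∞ M]
    {N : Type*} [TopologicalSpace N] [T2Space N] [SecondCountableTopology N]
    [ChartedSpace (EuclideanSpace ℝ (Fin n)) N] [IsManifold (𝓡 n) ∞ N]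
    (g : PseudoRiemannianMetric n M) (g' : PseudoRiemannianMetric n N)
    (hg : g.IsExceptionalEquidistant)
    (hmap : ∃ f : M ≃ₘ^∞⟮𝓡 n, 𝓡 n⟯ N, g.IsGeodesicMapping g' f) :
    g'.IsExceptionalEquidistant := by
  obtain ⟨f, hf⟩ := hmap
  exact LocalGeometry.isExceptionalEquidistant_of_isGeodesicMapping hg hf
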